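/- Let $k$ be a field, $S=k[z_1,\dots,z_N]$, and let $F\subset S$ be a set of irreducible homogeneous quadratic binomials (polynomials $a\,u+b\,v$ with $a,b\in k\setminus\{0\}$ and $u\neq v$ monomials of degree $2$), none of which is of the form $a z_i^2+b z_j^2$ (so that, up to rescaling of the variables and multiplication by a constant, each element of $F$ is $z_iz_j-z_pz_q$ or $z_i^2-z_pz_q$ with distinct variables; equivalently, each element of $F$ is irreducible over the algebraic closure of $k$). Assume that $F$ is irreducibly robust, that is, $F$ cannot be written as $F=G\cup H$ with $G,H$ nonempty and such that no variable occurs both in an element of $G$ and in an element of $H$ (robustness of $F$ itself is not part of this assumption). Call $F$ robust if $F$ is a universal Gröbner basis (for every monomial term order $<$, the leading terms of the elements of $F$ generate the initial ideal of $(F)$) and the elements of $F$ minimally generate their ideal (no proper subset of $F$ generates $(F)$). Then $F$ is robust if and only if $|F|=1$ or $F$ consists, up to a rescaling of the variables and multiplication of the individual polynomials by nonzero constants, of the $2\times 2$ minors of a generic $2\times n$ matrix $$\begin{pmatrix}x_1&\cdots&x_n\\ y_1&\cdots&y_n\end{pmatrix},$$ that is, there are $n\ge 0$, pairwise distinct variables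 $x_1,\dots,x_n,y_1,\dots,y_n$ among $z_1,\dots,z_N$, and nonzero constants $t_s$ (one for each variable) and $c_{ij}$ ($1\le i<j\le n$) such that $$F=\{\,c_{ij}\,\rho(x_iy_j-x_jy_i) : 1\le i<j\le n\,\},$$ where $\rho$ is the $k$-algebra map with $z_s\mapsto t_s z_s$. (The empty set $F$ is allowed, and corresponds to $n\le 1$.) -/

import Mathlib

namespace RobustQuadrics

open MvPolynomial

variable {k : Type*} [Field k] {n : ℕ}

/-- `F` is a Gröbner basis (of the ideal it generates) with respect to the term order `m`:
the leading terms of the elements of `F` generate the initial ideal of `(F)`. -/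
def IsGroebnerBasis (m : MonomialOrder.{0, 0} (Fin n)) (F : Set (MvPolynomial (Fin n) k)) : Prop :=
  Ideal.span (m.leadingTerm '' (Ideal.span F : Set (MvPolynomial (Fin n) k))) =
    Ideal.span (m.leadingTerm '' F)

/-- A universal Gröbner basis: a Gröbner basis for every term order. (Every term order on the
monomials in `n` variables is represented by a `MonomialOrder` whose `syn` lives in `Type`.) -/
def IsUniversalGroebnerBasis (F : Set (MvPolynomial (Fin n) k)) : Prop :=
  ∀ m : MonomialOrder.{0, 0} (Fin n), IsGroebnerBasis m F

/-- The elements of `F` minimally generate their ideal: no proper subset generates it. -/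
def MinimallyGenerates (F : Set (MvPolynomial (Fin n) k)) : Prop :=
  ∀ G : Set (MvPolynomial (Fin n) k), G ⊂ F → Ideal.span G ≠ Ideal.span F

/-- A robust set of polynomials. -/
def IsRobust (F : Set (MvPolynomial (Fin n) k)) : Prop :=
  IsUniversalGroebnerBasis F ∧ MinimallyGenerates F

/-- `F` cannot be written as a union of two nonempty sets of polynomials in disjoint sets of
variables. (Such a set is also called irreducibly robust; robustness itself is not part of the notion.) -/
def IsIndecomposable (F : Set (MvPolynomial (Fin n) k)) : Prop :=
  ¬ ∃ G H : Set (MvPolynomial (Fin n) k), G.Nonempty ∧ H.Nonempty ∧ F = G ∪ H ∧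
    ∀ g ∈ G, ∀ h ∈ H, Disjoint g.vars h.vars

/-- A quadratic binomial: a sum of two distinct monomials of degree two with nonzero
coefficients. -/
def IsQuadraticBinomial (f : MvPolynomial (Fin n) k) : Prop :=
  f.IsHomogeneous 2 ∧
    ∃ (u v : Fin n →₀ ℕ) (a b : k), u ≠ v ∧ a ≠ 0 ∧ b ≠ 0 ∧ f = monomial u a + monomial v b

/-- A linear combination of the squares of two variables. -/
def IsCombinationOfTwoSquares (f : MvPolynomial (Fin n) k) : Prop :=
  ∃ (i j : Fin n) (a b : k), f = C a * X i ^ 2 + C b * X j ^ 2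

/-- The `2 × m` matrix whose rows are the variables `X (x 0), …, X (x (m - 1))` and
`X (y 0), …, X (y (m - 1))`. It is generic if its entries are `2 * m` distinct variables, that is,
if `Sum.elim x y` is injective. -/
noncomputable def variableMatrix (k : Type*) [Field k] {n m : ℕ} (x y : Fin m → Fin n) :
    Matrix (Fin 2) (Fin m) (MvPolynomial (Fin n) k) :=
  Matrix.of ![fun j => X (x j), fun j => X (y j)]

/-- The `2 × 2` minor on the columns `i` and `j`. -/
noncomputable def minor {m : ℕ} (A : Matrix (Fin 2) (Fin m) (MvPolynomial (Fin n) k))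
    (i j : Fin m) : MvPolynomial (Fin n) k :=
  (A.submatrix id ![i, j]).det

/-- The rescaling `X s ↦ t s * X s` of the variables. -/
noncomputable def rescale (t : Fin n → kˣ) :
    MvPolynomial (Fin n) k →ₐ[k] MvPolynomial (Fin n) k :=
  aeval fun s => C (t s : k) * X s

/-- `F` consists of the `2 × 2` minors of a generic `2 × m` matrix, up to a rescaling of the
variables and up to multiplying each of the polynomials by a nonzero constant. There is exactly
one element of `F` for each pair of columns. -/
def IsRescaledGenericMinors (F : Set (MvPolynomial (Fin n) k)) : Prop :=
  ∃ (m : ℕ) (x y : Fin m → Fin n) (t : Fin n → kˣ) (c : Fin m → Fin m → kˣ),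
    Function.Injective (Sum.elim x y) ∧
      F = {f | ∃ i j : Fin m, i < j ∧
        f = C (c i j : k) * rescale t (minor (variableMatrix k x y) i j)}

end RobustQuadrics

/-! Robust implies minors. In a robust set distinct elements have distinct leading monomials for
every term order (`IsRobust.degree_injOn`), so a monomial occurs in at most one element, up to
nothing but its name. Suppose two elements z u - v₁ v₂ and z w - t₁ t₂ share the variable z
(coefficients suppressed). Their syzygy t₁ t₂ u - v₁ v₂ w lies in the ideal, so for every term order
its leading term is divisible by a leading monomial of F. A weight that is huge on z prevents t₁ t₂
from being a leading monomial, and suitable small weights on the other variables then force a shared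
variable y, so that the elements are z u - y v and z w - y t, and force t u - v w into F
(`not_disjoint`, `of_common`). Squares are excluded by `eq_of_square`. These three elements are the
minors of the matrix with rows (z, v, t) and (y, u, w).

Once F contains the minors of a matrix with at least three columns, any further element sharing a
variable with it supplies a new column (`extend_of_binom_mem`). Indecomposability provides such an
element until F is exhausted, and there are only finitely many variables.

Conversely, the minors vanish under the toric map x_i ↦ s y_i, up to rescaling. Two distinct
monomials with the same image are divisible by opposite terms of some minor
(`exists_quad_le_of_toricHom_eq`). Whichever of these terms leads, one of the two monomials is
reducible, so every remainder of an ideal element is zero, for all orders at once. -/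

namespace RobustQuadrics
open MvPolynomial

variable {k : Type*} [Field k] {n : ℕ}

open scoped MonomialOrder

/-! ### Weight orders and Gröbner bases. -/

/-- The total weight of an exponent vector, as an additive map. -/
noncomputable def weightHom (ω : Fin n → ℕ) : (Fin n →₀ ℕ) →+ ℕ :=
  Finsupp.liftAddHom fun s => (AddMonoidHom.mulLeft (ω s))

@[simp] lemma weightHom_single (ω : Fin n → ℕ) (s : Fin n) (c : ℕ) :
    weightHom ω (Finsupp.single s c) = ω s * c := by
  simp [weightHom]

/-- Exponent vectors mapped to pairs of weight and exponent vector, ordered lexicographically. -/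
noncomputable def weightLexHom (ω : Fin n → ℕ) :
    (Fin n →₀ ℕ) →+ (ℕ ×ₗ Lex (Fin n →₀ ℕ)) where
  toFun d := toLex (weightHom ω d, toLex d)
  map_zero' := by simp
  map_add' a b := by simp; rfl

lemma weightLexHom_injective (ω : Fin n → ℕ) : Function.Injective (weightLexHom ω) := by
  intro a b h
  simpa [weightLexHom] using congrArg (fun x => (ofLex x).2) h

/-- Exponent vectors are isomorphic to their images under `weightLexHom`. -/
noncomputable def weightLexEquiv (ω : Fin n → ℕ) :
    (Fin n →₀ ℕ) ≃+ AddMonoidHom.mrange (weightLexHom ω) :=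
  AddEquiv.ofBijective (weightLexHom ω).mrangeRestrict
    ⟨fun _ _ h => weightLexHom_injective ω (congrArg Subtype.val h),
      AddMonoidHom.mrangeRestrict_surjective _⟩

/-- The term order comparing weights first and breaking ties lexicographically. -/
noncomputable def weightOrder (ω : Fin n → ℕ) : MonomialOrder.{0, 0} (Fin n) where
  -- `toSyn` has to be an equivalence, so the order lives on the image of the injection into the
  -- lexicographic product, from which it inherits well-foundedness.
  syn := AddMonoidHom.mrange (weightLexHom ω)
  toSyn := weightLexEquiv ω
  toSyn_monotone a b h := by
    obtain ⟨c, rfl⟩ := exists_add_of_le h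
    change weightLexHom ω a ≤ weightLexHom ω (a + c)
    rw [map_add]
    have : 0 ≤ weightLexHom ω c := by
      change toLex (0, toLex 0) ≤ toLex (weightHom ω c, toLex c)
      rw [Prod.Lex.toLex_le_toLex']
      exact ⟨Nat.zero_le _, fun _ => Finsupp.toLex_monotone bot_le⟩
    exact le_add_of_nonneg_right this
  wellFoundedLT_syn := inferInstance

lemma weightOrder_lt (ω : Fin n → ℕ) {a b : Fin n →₀ ℕ} (h : weightHom ω a < weightHom ω b) :
    a ≺[weightOrder ω] b := by
  change weightLexHom ω a < weightLexHom ω b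
  exact Prod.Lex.toLex_lt_toLex.2 (Or.inl h)

/-- Over a field leading coefficients are units, so the initial ideals are monomial ideals, where
membership of a monomial is divisibility by a generator. -/
lemma isGroebnerBasis_iff (m : MonomialOrder.{0, 0} (Fin n)) (F : Set (MvPolynomial (Fin n) k)) :
    IsGroebnerBasis m F ↔
      ∀ p ∈ Ideal.span F, p ≠ 0 → ∃ f ∈ F, f ≠ 0 ∧ m.degree f ≤ m.degree p := by
  unfold IsGroebnerBasis
  constructor
  · intro h p hp hp0
    have h1 : m.leadingTerm p ∈ Ideal.span (m.leadingTerm '' F) := by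
      rw [← h]
      exact Ideal.subset_span ⟨p, hp, rfl⟩
    rw [m.span_leadingTerm_eq_span_monomial', ← Set.image_image (fun d => monomial d (1 : k)),
      mem_ideal_span_monomial_image] at h1
    obtain ⟨_, ⟨f, hf, rfl⟩, hd⟩ := h1 (m.degree p) (by
      rw [mem_support_iff, MonomialOrder.leadingTerm, coeff_monomial, if_pos rfl]
      exact MonomialOrder.leadingCoeff_ne_zero_iff.2 hp0)
    exact ⟨f, hf.1, hf.2, hd⟩
  · intro h
    apply le_antisymm _ (Ideal.span_mono (Set.image_mono Ideal.subset_span))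
    rw [Ideal.span_le]
    rintro _ ⟨p, hp, rfl⟩
    by_cases hp0 : p = 0
    · simp [hp0]
    obtain ⟨f, hf, hf0, hd⟩ := h p hp hp0
    rw [SetLike.mem_coe, m.span_leadingTerm_eq_span_monomial',
      ← Set.image_image (fun d => monomial d (1 : k)), mem_ideal_span_monomial_image]
    intro d hd'
    refine ⟨m.degree f, ⟨f, ⟨hf, hf0⟩, rfl⟩, ?_⟩
    have : d = m.degree p := by simpa using support_monomial_subset hd'
    rwa [this]

/-- If the leading terms of `G` generate the initial ideal of `I`, then `G` generates `I`. -/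
lemma mem_span_of_forall_degree_le (m : MonomialOrder.{0, 0} (Fin n))
    {G : Set (MvPolynomial (Fin n) k)} {I : Ideal (MvPolynomial (Fin n) k)}
    (hG : G ⊆ I) (h : ∀ p ∈ I, p ≠ 0 → ∃ f ∈ G, f ≠ 0 ∧ m.degree f ≤ m.degree p) :
    I = Ideal.span G := by
  apply le_antisymm _ (Ideal.span_le.2 hG)
  intro p hp
  obtain ⟨g, r, hgr, -, hr⟩ := m.div_set (B := {f ∈ G | f ≠ 0})
    (fun b hb => MonomialOrder.isUnit_leadingCoeff.2 hb.2) p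
  have hlin : Finsupp.linearCombination _
      (fun b : {f ∈ G | f ≠ 0} => (b : MvPolynomial (Fin n) k)) g ∈ Ideal.span G := by
    rw [Finsupp.linearCombination_apply]
    exact Submodule.sum_mem _ fun b _ =>
      Submodule.smul_mem _ _ (Ideal.subset_span b.2.1)
  have hrI : r ∈ I := by
    have : r = p - Finsupp.linearCombination _
      (fun b : {f ∈ G | f ≠ 0} => (b : MvPolynomial (Fin n) k)) g := by rw [hgr]; ring
    rw [this]
    exact I.sub_mem hp (Ideal.span_le.2 hG hlin)
  by_cases hr0 : r = 0
  · rw [hgr, hr0, add_zero]; exact hlin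
  · obtain ⟨f, hf, hf0, hd⟩ := h r hrI hr0
    exact absurd hd (hr _ (m.degree_mem_support hr0) f ⟨hf, hf0⟩)

/-- In a robust set distinct elements have distinct leading monomials. -/
lemma IsRobust.degree_injOn {F : Set (MvPolynomial (Fin n) k)} (hF : IsRobust F)
    (m : MonomialOrder.{0, 0} (Fin n)) {f g : MvPolynomial (Fin n) k} (hf : f ∈ F) (hg : g ∈ F)
    (hg0 : g ≠ 0) (h : m.degree f = m.degree g) : f = g := by
  by_contra hne
  -- Without f the leading monomials are the same, because g supplies that of f; so F \ {f} would
  -- still generate, against minimality.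
  refine hF.2 (F \ {f}) (Set.sdiff_singleton_ssubset.2 hf) (Eq.symm ?_)
  apply mem_span_of_forall_degree_le m (Set.sdiff_subset.trans Ideal.subset_span)
  intro p hp hp0
  obtain ⟨e, he, he0, hd⟩ := (isGroebnerBasis_iff m F).1 (hF.1 m) p hp hp0
  by_cases hef : e = f
  · subst hef
    exact ⟨g, ⟨hg, fun h' => hne h'.symm⟩, hg0, h ▸ hd⟩
  · exact ⟨e, ⟨he, hef⟩, he0, hd⟩

/-- A monomial of strictly maximal weight is the leading monomial. -/
lemma degree_weightOrder (ω : Fin n → ℕ) {p : MvPolynomial (Fin n) k} {d : Fin n →₀ ℕ}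
    (hd : d ∈ p.support) (h : ∀ e ∈ p.support, e ≠ d → weightHom ω e < weightHom ω d) :
    (weightOrder ω).degree p = d := by
  by_contra hne
  have h1 := weightOrder_lt ω (h _ ((weightOrder ω).degree_mem_support
    (fun h0 => by simp [h0] at hd)) hne)
  exact absurd (MonomialOrder.le_degree hd) (not_le.2 h1)

lemma weightHom_le_weightHom_degree (ω : Fin n → ℕ) {p : MvPolynomial (Fin n) k} {d : Fin n →₀ ℕ}
    (hd : d ∈ p.support) : weightHom ω d ≤ weightHom ω ((weightOrder ω).degree p) := by
  by_contra hlt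
  exact absurd (MonomialOrder.le_degree hd) (not_le.2 (weightOrder_lt ω (not_le.1 hlt)))

/-- The way term orders are used: if a monomial of an element of the ideal has strictly maximal
weight, then it is divisible by a monomial of maximal weight of an element of `F`. -/
lemma IsUniversalGroebnerBasis.exists_le {F : Set (MvPolynomial (Fin n) k)}
    (hF : IsUniversalGroebnerBasis F) (ω : Fin n → ℕ) {p : MvPolynomial (Fin n) k}
    (hp : p ∈ Ideal.span F) {d : Fin n →₀ ℕ} (hd : d ∈ p.support)
    (h : ∀ e ∈ p.support, e ≠ d → weightHom ω e < weightHom ω d) :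
    ∃ f ∈ F, ∃ u ∈ f.support, u ≤ d ∧ ∀ v ∈ f.support, weightHom ω v ≤ weightHom ω u := by
  obtain ⟨f, hf, hf0, hle⟩ := (isGroebnerBasis_iff _ F).1 (hF (weightOrder ω)) p hp
    (fun h0 => by simp [h0] at hd)
  rw [degree_weightOrder ω hd h] at hle
  exact ⟨f, hf, _, (weightOrder ω).degree_mem_support hf0, hle,
    fun v hv => weightHom_le_weightHom_degree ω hv⟩

/-! ### Combinatorics of the monomials in a robust set, with coefficients forgotten. -/

variable {σ : Type*}

/-- `P a b p q` abstracts the statement that a fixed robust set of quadratic binomials has an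
element with the monomials `X a * X b` and `X p * X q`. -/
structure IsBinomialPattern (P : σ → σ → σ → σ → Prop) : Prop where
  swap : ∀ {a b p q}, P a b p q → P p q a b
  comm : ∀ {a b p q}, P a b p q → P b a p q
  ne : ∀ {a b p q}, P a b p q → a ≠ p
  not_squares : ∀ {a p}, ¬ P a a p p
  unique : ∀ {a b p q p' q'}, P a b p q → P a b p' q' → (p = p' ∧ q = q') ∨ (p = q' ∧ q = p')
  -- The syzygy of the two elements has the monomials t₁ t₂ u and v₁ v₂ w. If the first is heavier,
  -- one of its quadratic divisors leads an element; the inequalities are weak because ties in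
  -- weight are broken lexicographically.
  reduces : ∀ {z u w v₁ v₂ t₁ t₂}, P z u v₁ v₂ → P z w t₁ t₂ → u ≠ w → ∀ ω : σ → ℕ,
    ω v₁ + ω v₂ + ω w < ω t₁ + ω t₂ + ω u →
      (∃ p q, P t₁ t₂ p q ∧ ω p + ω q ≤ ω t₁ + ω t₂) ∨
      (∃ p q, P t₁ u p q ∧ ω p + ω q ≤ ω t₁ + ω u) ∨
      (∃ p q, P t₂ u p q ∧ ω p + ω q ≤ ω t₂ + ω u)

namespace IsBinomialPattern

variable {P : σ → σ → σ → σ → Prop} (hP : IsBinomialPattern P)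
include hP

lemma comm' {a b p q : σ} (h : P a b p q) : P a b q p := hP.swap (hP.comm (hP.swap h))

lemma disjoint {a b p q : σ} (h : P a b p q) : a ≠ p ∧ a ≠ q ∧ b ≠ p ∧ b ≠ q :=
  ⟨hP.ne h, hP.ne (hP.comm' h), hP.ne (hP.comm h), hP.ne (hP.comm (hP.comm' h))⟩

/-- In the situation of `reduces`, a weight that is large on `z` rules out the first case. -/
lemma reduces_of_heavy {z u w v₁ v₂ t₁ t₂ : σ} (hf : P z u v₁ v₂) (hg : P z w t₁ t₂) (huw : u ≠ w)
    (ω : σ → ℕ) (hz : ω t₁ + ω t₂ < ω z) (h : ω v₁ + ω v₂ + ω w < ω t₁ + ω t₂ + ω u) :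
      (∃ p q, P t₁ u p q ∧ ω p + ω q ≤ ω t₁ + ω u) ∨
      (∃ p q, P t₂ u p q ∧ ω p + ω q ≤ ω t₂ + ω u) := by
  rcases hP.reduces hf hg huw ω h with ⟨p, q, hpq, hle⟩ | h | h
  · rcases hP.unique hpq (hP.swap hg) with ⟨rfl, rfl⟩ | ⟨rfl, rfl⟩ <;> omega
  · exact Or.inl h
  · exact Or.inr h

/-- If the pairs were disjoint, some weight would make t₁ t₂ u heavier than v₁ v₂ w while every
possible partner of t₁ u or t₂ u is too heavy. When some t_i equals u, one of these monomials may be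
t₁ t₂ itself, whose partner z w is heavy. -/
lemma not_disjoint {z u w v₁ v₂ t₁ t₂ : σ} (hf : P z u v₁ v₂) (hg : P z w t₁ t₂) (huw : u ≠ w)
    (hzu : z ≠ u) (hzw : z ≠ w) : t₁ = v₁ ∨ t₁ = v₂ ∨ t₂ = v₁ ∨ t₂ = v₂ := by
  classical
  by_contra! hd
  obtain ⟨f1, f2, f3, f4⟩ := hP.disjoint hf
  obtain ⟨g1, g2, g3, g4⟩ := hP.disjoint hg
  obtain ⟨d1, d2, d3, d4⟩ := hd
  have hg' := hP.swap hg
  by_cases h1 : t₁ = u <;> by_cases h2 : t₂ = u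
  · subst h1 h2
    rcases hP.reduces_of_heavy hf hg huw
      (fun s => if s = z then 1000 else if s = t₂ then 5 else 3) (by grind) (by grind)
      with ⟨p, q, hpq, hle⟩ | ⟨p, q, hpq, hle⟩ <;>
    · have := hP.unique hpq hg'
      grind
  · subst h1
    rcases hP.reduces_of_heavy hf hg huw
      (fun s => if s = z then 1000 else if s = t₂ then 100 else if s = t₁ then 2 else 3)
      (by grind) (by grind) with ⟨p, q, hpq, hle⟩ | ⟨p, q, hpq, hle⟩
    · have := hP.disjoint hpq
      grind
    · have := hP.unique (hP.comm hpq) hg'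
      grind
  · subst h2
    rcases hP.reduces_of_heavy hf hg huw
      (fun s => if s = z then 1000 else if s = t₁ then 100 else if s = t₂ then 2 else 3)
      (by grind) (by grind) with ⟨p, q, hpq, hle⟩ | ⟨p, q, hpq, hle⟩
    · have := hP.unique hpq hg'
      grind
    · have := hP.disjoint hpq
      grind
  · rcases hP.reduces_of_heavy hf hg huw
      (fun s => if s = z then 1000 else if s = t₁ ∨ s = t₂ then 5 else if s = u then 0 else 3)
      (by grind) (by grind) with ⟨p, q, hpq, hle⟩ | ⟨p, q, hpq, hle⟩ <;>
    · have := hP.disjoint hpq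
      grind

/-- The syzygy is y times a combination of t u and v w. If these did not form an element, a weight
could be chosen for which neither y u nor t u leads an element although y t u leads the syzygy. -/
lemma of_common {z u w y v t : σ} (hf : P z u y v) (hg : P z w y t) (huw : u ≠ w)
    (hzu : z ≠ u) (hzw : z ≠ w) : P t u v w := by
  classical
  by_contra hn
  obtain ⟨f1, f2, f3, f4⟩ := hP.disjoint hf
  obtain ⟨g1, g2, g3, g4⟩ := hP.disjoint hg
  have hg' := hP.swap hg
  have htv : t ≠ v := by
    rintro rfl
    have := hP.unique hg' (hP.swap hf)
    grind
  have key : ∀ ω : σ → ℕ, ω y + ω t < ω z → ω v + ω w < ω t + ω u →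
      (t ≠ u → ∀ p q, P y u p q → ω y + ω u < ω p + ω q) →
      (∀ p q, P t u p q → ω t + ω u < ω p + ω q) → False := by
    intro ω hz h h1 h2
    rcases hP.reduces_of_heavy hf hg huw ω hz (by omega) with ⟨p, q, hpq, hle⟩ | ⟨p, q, hpq, hle⟩
    · by_cases htu : t = u
      · subst htu
        have := hP.unique hpq hg'
        grind
      · exact absurd hle (not_le.2 (h1 htu p q hpq))
    · exact absurd hle (not_le.2 (h2 p q hpq))
  have hdy : ∀ p q, P y u p q → y ≠ p ∧ y ≠ q ∧ u ≠ p ∧ u ≠ q := fun p q h => hP.disjoint h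
  by_cases hs : ∃ p q, P t u p q
  · obtain ⟨p, q, hpq⟩ := hs
    have hpq' : ¬ ((p = v ∧ q = w) ∨ (p = w ∧ q = v)) := by
      rintro (⟨rfl, rfl⟩ | ⟨rfl, rfl⟩)
      · exact hn hpq
      · exact hn (hP.comm' hpq)
    -- By uniqueness p q is the only partner of t u, so it suffices to arrange v w < t u < p q, with
    -- z heavy and y u lighter than every pair avoiding y and u. The last condition is void for t =
    -- u, where y u has partner z w, and for t = y, where y u is t u.
    have key2 : ∀ ω : σ → ℕ, ω y + ω t < ω z → ω v + ω w < ω t + ω u → ω t + ω u < ω p + ω q →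
        (t ≠ u → t ≠ y → ∀ p' q', y ≠ p' ∧ y ≠ q' ∧ u ≠ p' ∧ u ≠ q' →
          ω y + ω u < ω p' + ω q') → False := by
      intro ω hz h h2 h1
      refine key ω hz h (fun htu p' q' h' => ?_) (fun p' q' h' => ?_)
      · by_cases hty : t = y
        · subst hty
          have := hP.unique hpq h'
          grind
        · exact h1 htu hty p' q' (hdy _ _ h')
      · have := hP.unique hpq h'
        grind
    obtain ⟨d1, d2, d3, d4⟩ := hP.disjoint hpq
    -- As p q differs from v w, it either contains a variable outside {v, w}, which can be made
    -- heavy, or is the square of v or w.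
    have hcases : (p ≠ v ∧ p ≠ w) ∨ (q ≠ v ∧ q ≠ w) ∨ (p = v ∧ q = v) ∨ (p = w ∧ q = w) := by
      grind
    clear key hn hg hf hg' hpq hdy
    by_cases htuy : t = u ∨ t = y
    · rcases hcases with h | h | h | h
      · exact key2 (fun s => if s = z then 1000 else if s = p then 100 else
          if s = v ∨ s = w then 0 else 1) (by grind) (by grind) (by grind) (by grind)
      · exact key2 (fun s => if s = z then 1000 else if s = q then 100 else
          if s = v ∨ s = w then 0 else 1) (by grind) (by grind) (by grind) (by grind)
      · exact key2 (fun s => if s = z then 1000 else if s = v then 3 else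
          if s = w then 0 else 2) (by grind) (by grind) (by grind) (by grind)
      · exact key2 (fun s => if s = z then 1000 else if s = w then 3 else
          if s = v then 0 else 2) (by grind) (by grind) (by grind) (by grind)
    push Not at htuy
    -- Here t u weighs 9, and the weights of y and w are set around 4 so that v w stays below 9 and
    -- p q above it.
    by_cases hyv : y = v
    · by_cases hyy : p = y ∧ q = y
      · exact key2 (fun s => if s = z then 1000 else if s = y then 5 else if s = w then 3 else
          if s = t then 9 else if s = u then 0 else 100)
          (by grind) (by grind) (by grind) (by grind)
      by_cases hww : p = w ∧ q = w
      · exact key2 (fun s => if s = z then 1000 else if s = y then 2 else if s = w then 5 else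
          if s = t then 9 else if s = u then 0 else 100)
          (by grind) (by grind) (by grind) (by grind)
      · exact key2 (fun s => if s = z then 1000 else if s = y ∨ s = w then 4 else
          if s = t then 9 else if s = u then 0 else 100)
          (by grind) (by grind) (by grind) (by grind)
    by_cases hypq : y = p ∨ y = q
    · exact key2 (fun s => if s = z then 1000 else if s = y then 6 else if s = v ∨ s = w then 4 else
          if s = t then 9 else if s = u then 0 else 100)
          (by grind) (by grind) (by grind) (by grind)
    -- Now y divides none of the monomials being compared, so it can weigh 0; this makes y u lighter
    -- than any pair avoiding y and u.
    rcases hcases with h | h | h | h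
    · exact key2 (fun s => if s = z then 1000 else if s = p then 100 else if s = t then 2 else
        if s = y then 0 else 1) (by grind) (by grind) (by grind) (by grind)
    · exact key2 (fun s => if s = z then 1000 else if s = q then 100 else if s = t then 2 else
        if s = y then 0 else 1) (by grind) (by grind) (by grind) (by grind)
    · exact key2 (fun s => if s = z then 1000 else if s = v then 3 else if s = t then 4 else
        if s = y then 0 else 1) (by grind) (by grind) (by grind) (by grind)
    · exact key2 (fun s => if s = z then 1000 else if s = w then 3 else if s = t then 4 else
        if s = y then 0 else 1) (by grind) (by grind) (by grind) (by grind)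
  · push Not at hs
    by_cases htuy : t = u ∨ t = y
    · refine key (fun s => if s = z then 1000 else if s = v ∨ s = w then 0 else 1)
        (by grind) (by grind) ?_ (fun p q h => absurd h (hs p q))
      rcases htuy with h | rfl
      · exact fun h' => absurd h h'
      · exact fun _ p q h => absurd h (hs p q)
    · refine key (fun s => if s = z then 1000 else if s = t then 100 else if s = u then 0 else 1)
        (by grind) (by grind) (fun _ p q h => ?_) (fun p q h => absurd h (hs p q))
      have := hdy p q h
      grind

/-- Two elements with different monomials divisible by `z`: the other monomials share a variable,
and the two-term syzygy gives another element. -/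
lemma exists_common {z u w v₁ v₂ t₁ t₂ : σ} (hf : P z u v₁ v₂) (hg : P z w t₁ t₂) (huw : u ≠ w)
    (hzu : z ≠ u) (hzw : z ≠ w) :
    ∃ y v t, ((v₁ = y ∧ v₂ = v) ∨ (v₁ = v ∧ v₂ = y)) ∧ ((t₁ = y ∧ t₂ = t) ∨ (t₁ = t ∧ t₂ = y)) ∧
      P t u v w := by
  rcases hP.not_disjoint hf hg huw hzu hzw with rfl | rfl | rfl | rfl
  · exact ⟨_, _, _, Or.inl ⟨rfl, rfl⟩, Or.inl ⟨rfl, rfl⟩, hP.of_common hf hg huw hzu hzw⟩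
  · exact ⟨_, _, _, Or.inr ⟨rfl, rfl⟩, Or.inl ⟨rfl, rfl⟩,
      hP.of_common (hP.comm' hf) hg huw hzu hzw⟩
  · exact ⟨_, _, _, Or.inl ⟨rfl, rfl⟩, Or.inr ⟨rfl, rfl⟩,
      hP.of_common hf (hP.comm' hg) huw hzu hzw⟩
  · exact ⟨_, _, _, Or.inr ⟨rfl, rfl⟩, Or.inr ⟨rfl, rfl⟩,
      hP.of_common (hP.comm' hf) (hP.comm' hg) huw hzu hzw⟩

/-- Two elements `z w - t₁ t₂` and `z t₁ - s₁ s₂` cannot occur together. -/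
lemma not_chain {z w t₁ t₂ s₁ s₂ : σ} (hg : P z w t₁ t₂) (h : P z t₁ s₁ s₂)
    (hzw : z ≠ w) : False := by
  obtain ⟨g1, g2, g3, g4⟩ := hP.disjoint hg
  obtain ⟨d1, d2, d3, d4⟩ := hP.disjoint h
  obtain ⟨y, v, s, hv, hs, hP1⟩ := hP.exists_common hg h g3 hzw g1
  have h12 : t₁ ≠ t₂ := by grind
  -- The shared variable cannot be t₁, which is coprime to s₁ s₂. Hence s₁ s₂ = t₂ s, and the syzygy
  -- yields an element with monomials s w and t₁².
  have hy : y = t₂ := by grind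
  have hvt : v = t₁ := by grind
  subst hy hvt
  have h' : P v z s y := by
    rcases hs with ⟨rfl, rfl⟩ | ⟨rfl, rfl⟩
    · exact hP.comm' (hP.comm h)
    · exact hP.comm h
  -- The same argument at t₁, with monomials t₁ t₂ and t₁ z, makes z w and s t₂ share a variable.
  -- That can only be w = s, so the element above becomes a combination of two squares.
  obtain ⟨y', v', t', hv', ht', hP2⟩ :=
    hP.exists_common (hP.swap hg) h' (Ne.symm g2) h12 (Ne.symm g1)
  have hws : w = s := by grind
  subst hws
  exact hP.not_squares hP1

/-- A variable whose square occurs in one element occurs in no other monomial. -/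
lemma eq_of_square {z w v₁ v₂ t₁ t₂ : σ} (hf : P z z v₁ v₂) (hg : P z w t₁ t₂) : z = w := by
  classical
  by_contra hzw
  obtain ⟨f1, f2, f3, f4⟩ := hP.disjoint hf
  obtain ⟨g1, g2, g3, g4⟩ := hP.disjoint hg
  -- The leading term of the syzygy is t₁ t₂ z, so z t₁ or z t₂ occurs in an element, contrary to
  -- `not_chain`.
  rcases hP.reduces_of_heavy hf hg hzw (fun s => if s = z then 1000 else 3)
    (by grind) (by grind) with ⟨p, q, hpq, -⟩ | ⟨p, q, hpq, -⟩
  · exact hP.not_chain hg (hP.comm hpq) hzw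
  · exact hP.not_chain (hP.comm' hg) (hP.comm hpq) hzw

end IsBinomialPattern

/-! ### Quadratic monomials and the normal form of the binomials. -/

/-- The exponent vector of `X i * X j`. -/
noncomputable def quad (i j : Fin n) : Fin n →₀ ℕ := Finsupp.single i 1 + Finsupp.single j 1

lemma quad_comm (i j : Fin n) : quad i j = quad j i := add_comm _ _

lemma quad_apply (i j s : Fin n) :
    quad i j s = (if i = s then 1 else 0) + (if j = s then 1 else 0) := by
  simp [quad, Finsupp.single_apply]

lemma weightHom_quad (ω : Fin n → ℕ) (i j : Fin n) : weightHom ω (quad i j) = ω i + ω j := by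
  simp [quad]

lemma quad_inj {a b p q : Fin n} : quad a b = quad p q ↔ (a = p ∧ b = q) ∨ (a = q ∧ b = p) := by
  constructor
  · intro h
    have ha := DFunLike.congr_fun h a
    have hb := DFunLike.congr_fun h b
    simp only [quad_apply] at ha hb
    grind
  · rintro (⟨rfl, rfl⟩ | ⟨rfl, rfl⟩)
    · rfl
    · exact quad_comm _ _

lemma exists_eq_quad {d : Fin n →₀ ℕ} (h : d.degree = 2) : ∃ i j, d = quad i j := by
  have h0 : d ≠ 0 := by rintro rfl; simp at h
  obtain ⟨i, hi⟩ := Finsupp.ne_iff.1 h0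
  have hle : Finsupp.single i 1 ≤ d := by
    rw [Finsupp.single_le_iff]; exact Nat.one_le_iff_ne_zero.2 hi
  obtain ⟨e, rfl⟩ := exists_add_of_le hle
  have he : e.degree = 1 := by simpa [map_add, Nat.one_add, Nat.add_eq_right] using h
  have h1 : e ≠ 0 := by rintro rfl; simp at he
  obtain ⟨j, hj⟩ := Finsupp.ne_iff.1 h1
  have hle : Finsupp.single j 1 ≤ e := by
    rw [Finsupp.single_le_iff]; exact Nat.one_le_iff_ne_zero.2 hj
  obtain ⟨e', rfl⟩ := exists_add_of_le hle
  have : e' = 0 := by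
    rw [← Finsupp.degree_eq_zero_iff]
    simpa [map_add] using he
  exact ⟨i, j, by simp [this, quad]⟩

lemma quad_le {a b p q r : Fin n} (h : quad a b ≤ quad p q + Finsupp.single r 1) :
    quad a b = quad p q ∨ quad a b = quad p r ∨ quad a b = quad q r := by
  have ha := h a
  have hb := h b
  simp only [Finsupp.add_apply, quad_apply, Finsupp.single_apply] at ha hb
  simp only [quad_inj]
  grind

/-- The binomial `α X a X b + β X p X q`. -/
noncomputable def binom (a b p q : Fin n) (α β : k) : MvPolynomial (Fin n) k :=
  monomial (quad a b) α + monomial (quad p q) β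

lemma binom_comm_left (a b p q : Fin n) (α β : k) : binom a b p q α β = binom b a p q α β := by
  rw [binom, binom, quad_comm a b]

lemma binom_comm_right (a b p q : Fin n) (α β : k) : binom a b p q α β = binom a b q p α β := by
  rw [binom, binom, quad_comm p q]

lemma binom_swap (a b p q : Fin n) (α β : k) : binom a b p q α β = binom p q a b β α := by
  rw [binom, binom, add_comm]

/-- The normal form of the elements of `F`. -/
def IsNormal (f : MvPolynomial (Fin n) k) : Prop :=
  ∃ (a b p q : Fin n) (α β : k), α ≠ 0 ∧ β ≠ 0 ∧ f = binom a b p q α β ∧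
    (a ≠ p ∧ a ≠ q ∧ b ≠ p ∧ b ≠ q) ∧ ¬ (a = b ∧ p = q)

lemma not_irreducible_binom (a b q : Fin n) (α β : k) : ¬ Irreducible (binom a b a q α β) := by
  intro h
  have he : binom a b a q α β =
      X a * (monomial (Finsupp.single b 1) α + monomial (Finsupp.single q 1) β) := by
    rw [X, mul_add, monomial_mul, monomial_mul, one_mul, one_mul]; rfl
  rcases h.isUnit_or_isUnit he with h | h
  · simpa using h.map (constantCoeff (σ := Fin n) (R := k))
  · have := h.map (constantCoeff (σ := Fin n) (R := k))
    simp [constantCoeff_monomial] at this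

lemma isNormal_of {f : MvPolynomial (Fin n) k} (hb : IsQuadraticBinomial f) (hi : Irreducible f)
    (hs : ¬ IsCombinationOfTwoSquares f) : IsNormal f := by
  obtain ⟨hh, u, v, α, β, huv, hα, hβ, rfl⟩ := hb
  have hu : u.degree = 2 := by
    rw [Finsupp.degree_eq_weight_one]
    exact hh (d := u) (by simp [coeff_monomial, huv.symm, hα])
  have hv : v.degree = 2 := by
    rw [Finsupp.degree_eq_weight_one]
    exact hh (d := v) (by simp [coeff_monomial, huv, hβ])
  obtain ⟨a, b, rfl⟩ := exists_eq_quad hu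
  obtain ⟨p, q, rfl⟩ := exists_eq_quad hv
  refine ⟨a, b, p, q, α, β, hα, hβ, rfl, ⟨?_, ?_, ?_, ?_⟩, ?_⟩
  · rintro rfl; exact not_irreducible_binom _ _ _ _ _ hi
  · rintro rfl; rw [quad_comm p] at hi; exact not_irreducible_binom _ _ _ _ _ hi
  · rintro rfl; rw [quad_comm a] at hi; exact not_irreducible_binom _ _ _ _ _ hi
  · rintro rfl; rw [quad_comm a, quad_comm p] at hi; exact not_irreducible_binom _ _ _ _ _ hi
  · rintro ⟨rfl, rfl⟩
    refine hs ⟨a, p, α, β, ?_⟩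
    rw [quad, quad, ← Finsupp.single_add, ← Finsupp.single_add, X_pow_eq_monomial,
      X_pow_eq_monomial, C_mul_monomial, C_mul_monomial, mul_one, mul_one]

lemma mem_support_binom {a b p q : Fin n} {α β : k} {d : Fin n →₀ ℕ}
    (h : d ∈ (binom a b p q α β).support) : d = quad a b ∨ d = quad p q := by
  rw [mem_support_iff, binom, coeff_add, coeff_monomial, coeff_monomial] at h
  by_contra! h'
  simp [h'.1.symm, h'.2.symm] at h

lemma coeff_binom_left {a b p q : Fin n} (h : a ≠ p ∧ a ≠ q ∧ b ≠ p ∧ b ≠ q) (α β : k) :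
    coeff (quad a b) (binom a b p q α β) = α := by
  have : quad p q ≠ quad a b := by rw [Ne, quad_inj]; grind
  simp [binom, coeff_monomial, this]

lemma coeff_binom_right {a b p q : Fin n} (h : a ≠ p ∧ a ≠ q ∧ b ≠ p ∧ b ≠ q) (α β : k) :
    coeff (quad p q) (binom a b p q α β) = β := by
  have : quad a b ≠ quad p q := by rw [Ne, quad_inj]; grind
  simp [binom, coeff_monomial, this]

/-! ### From robust sets to binomial patterns, and the coefficients of the third element. -/

/-- Some element of `F` is a combination of `X a * X b` and `X p * X q`. -/
def HasBinom (F : Set (MvPolynomial (Fin n) k)) (a b p q : Fin n) : Prop :=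
  ∃ α β : k, α ≠ 0 ∧ β ≠ 0 ∧ binom a b p q α β ∈ F

section Robust

variable {F : Set (MvPolynomial (Fin n) k)} (hN : ∀ f ∈ F, IsNormal f)
include hN

lemma disjoint_of_mem {a b p q : Fin n} {α β : k} (h : binom a b p q α β ∈ F) :
    (a ≠ p ∧ a ≠ q ∧ b ≠ p ∧ b ≠ q) ∧ ¬ (a = b ∧ p = q) := by
  obtain ⟨a', b', p', q', α', β', hα', hβ', he, hd, hs⟩ := hN _ h
  have h1 : quad a' b' ∈ (binom a b p q α β).support := by
    rw [mem_support_iff, he, coeff_binom_left hd]; exact hα'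
  have h2 : quad p' q' ∈ (binom a b p q α β).support := by
    rw [mem_support_iff, he, coeff_binom_right hd]; exact hβ'
  have h1 := mem_support_binom h1
  have h2 := mem_support_binom h2
  rw [quad_inj, quad_inj] at h1 h2
  grind

variable (hF : IsRobust F)
include hF

/-- Weight 1 on a and b and 0 elsewhere makes the common monomial lead both elements, since the two
monomials of an element are coprime. -/
lemma eq_of_common_monomial {a b p q p' q' : Fin n} {α β α' β' : k} (hα : α ≠ 0) (hβ : β ≠ 0)
    (hα' : α' ≠ 0) (hβ' : β' ≠ 0) (h : binom a b p q α β ∈ F) (h' : binom a b p' q' α' β' ∈ F) :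
    binom a b p q α β = binom a b p' q' α' β' := by
  classical
  have key : ∀ {p q : Fin n} {α β : k}, α ≠ 0 → β ≠ 0 → binom a b p q α β ∈ F →
      (weightOrder fun s => if s = a ∨ s = b then 1 else 0).degree (binom a b p q α β) =
        quad a b := by
    intro p q α β hα hβ h
    obtain ⟨hd, -⟩ := disjoint_of_mem hN h
    apply degree_weightOrder
    · rw [mem_support_iff, coeff_binom_left hd]; exact hα
    · intro e he hne
      rcases mem_support_binom he with rfl | rfl
      · exact absurd rfl hne
      · rw [weightHom_quad, weightHom_quad]; grind
  refine hF.degree_injOn _ h h' ?_ ((key hα hβ h).trans (key hα' hβ' h').symm)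
  intro h0
  have := coeff_binom_left (disjoint_of_mem hN h').1 α' β'
  rw [h0] at this
  exact hα' (by simpa using this.symm)

lemma HasBinom.unique {a b p q p' q' : Fin n} (h : HasBinom F a b p q)
    (h' : HasBinom F a b p' q') : (p = p' ∧ q = q') ∨ (p = q' ∧ q = p') := by
  obtain ⟨α, β, hα, hβ, h⟩ := h
  obtain ⟨α', β', hα', hβ', h'⟩ := h'
  have he := eq_of_common_monomial hN hF hα hβ hα' hβ' h h'
  obtain ⟨hd, -⟩ := disjoint_of_mem hN h
  have : quad p q ∈ (binom a b p' q' α' β').support := by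
    rw [mem_support_iff, ← he, coeff_binom_right hd]; exact hβ
  have := mem_support_binom this
  rw [quad_inj, quad_inj] at this
  grind

/-- A cubic monomial of strictly maximal weight in an element of the ideal is divisible by a
monomial of maximal weight of an element of `F`. -/
lemma exists_hasBinom (ω : Fin n → ℕ) {P : MvPolynomial (Fin n) k}
    (hP : P ∈ Ideal.span F) {a b c : Fin n}
    (hd : quad a b + Finsupp.single c 1 ∈ P.support)
    (h : ∀ e ∈ P.support, e ≠ quad a b + Finsupp.single c 1 →
      weightHom ω e < ω a + ω b + ω c) :
    (∃ p q, HasBinom F a b p q ∧ ω p + ω q ≤ ω a + ω b) ∨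
    (∃ p q, HasBinom F a c p q ∧ ω p + ω q ≤ ω a + ω c) ∨
    (∃ p q, HasBinom F b c p q ∧ ω p + ω q ≤ ω b + ω c) := by
  have hw : weightHom ω (quad a b + Finsupp.single c 1) = ω a + ω b + ω c := by
    rw [map_add, weightHom_quad, weightHom_single, mul_one]
  obtain ⟨f, hf, u, hu, hud, hmax⟩ := hF.1.exists_le ω hP hd (by rwa [hw])
  obtain ⟨a', b', p', q', u', v', rfl, hle, hB⟩ : ∃ (a' b' p' q' : Fin n) (α β : k),
      u = quad a' b' ∧ ω p' + ω q' ≤ ω a' + ω b' ∧ (α ≠ 0 ∧ β ≠ 0 ∧ binom a' b' p' q' α β ∈ F) := by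
    obtain ⟨a', b', p', q', α, β, hα, hβ, rfl, hd, -⟩ := hN f hf
    rcases mem_support_binom hu with rfl | rfl
    · refine ⟨a', b', p', q', α, β, rfl, ?_, hα, hβ, hf⟩
      have := hmax (quad p' q') (by rw [mem_support_iff, coeff_binom_right hd]; exact hβ)
      rwa [weightHom_quad, weightHom_quad] at this
    · refine ⟨p', q', a', b', β, α, rfl, ?_, hβ, hα, by rwa [binom_swap]⟩
      have := hmax (quad a' b') (by rw [mem_support_iff, coeff_binom_left hd]; exact hα)
      rwa [weightHom_quad, weightHom_quad] at this
  have key : ∀ {r s : Fin n}, quad a' b' = quad r s →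
      ∃ p q, HasBinom F r s p q ∧ ω p + ω q ≤ ω r + ω s := by
    intro r s hrs
    refine ⟨p', q', ⟨u', v', hB.1, hB.2.1, ?_⟩, ?_⟩
    · have := hB.2.2
      rwa [binom, hrs] at this
    · rw [← weightHom_quad ω r s, ← hrs, weightHom_quad]; exact hle
  rcases quad_le hud with h | h | h
  · exact Or.inl (key h)
  · exact Or.inr (Or.inl (key h))
  · exact Or.inr (Or.inr (key h))

omit hN hF in
lemma syzygy_mem {z u w v₁ v₂ t₁ t₂ : Fin n} {α β γ δ : k}
    (hf : binom z u v₁ v₂ α β ∈ F) (hg : binom z w t₁ t₂ γ δ ∈ F) :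
    monomial (quad t₁ t₂ + Finsupp.single u 1) (α * δ) -
      monomial (quad v₁ v₂ + Finsupp.single w 1) (β * γ) ∈ Ideal.span F := by
  have : monomial (quad t₁ t₂ + Finsupp.single u 1) (α * δ) -
      monomial (quad v₁ v₂ + Finsupp.single w 1) (β * γ) =
      monomial (Finsupp.single u 1) α * binom z w t₁ t₂ γ δ -
      monomial (Finsupp.single w 1) γ * binom z u v₁ v₂ α β := by
    have e : Finsupp.single u 1 + quad z w = Finsupp.single w 1 + quad z u := by
      simp only [quad]; abel
    simp only [binom, mul_add, monomial_mul, e, mul_comm γ α, mul_comm γ β,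
      add_comm (Finsupp.single u 1) (quad t₁ t₂), add_comm (Finsupp.single w 1) (quad v₁ v₂)]
    ring
  rw [this]
  exact sub_mem (Ideal.mul_mem_left _ _ (Ideal.subset_span hg))
    (Ideal.mul_mem_left _ _ (Ideal.subset_span hf))

lemma isBinomialPattern : IsBinomialPattern (HasBinom F) where
  swap := fun ⟨α, β, hα, hβ, h⟩ => ⟨β, α, hβ, hα, by rwa [binom_swap]⟩
  comm := fun ⟨α, β, hα, hβ, h⟩ => ⟨α, β, hα, hβ, by rwa [binom_comm_left]⟩
  ne := fun ⟨α, β, hα, hβ, h⟩ => (disjoint_of_mem hN h).1.1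
  not_squares := fun ⟨α, β, hα, hβ, h⟩ => (disjoint_of_mem hN h).2 ⟨rfl, rfl⟩
  unique := HasBinom.unique hN hF
  reduces := by
    rintro z u w v₁ v₂ t₁ t₂ ⟨α, β, hα, hβ, hf⟩ ⟨γ, δ, hγ, hδ, hg⟩ - ω hω
    have hne : quad v₁ v₂ + Finsupp.single w 1 ≠ quad t₁ t₂ + Finsupp.single u 1 := by
      intro h
      have := congrArg (weightHom ω) h
      simp only [map_add, weightHom_quad, weightHom_single, mul_one] at this
      omega
    refine exists_hasBinom hN hF ω (syzygy_mem hf hg) ?_ ?_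
    · rw [mem_support_iff, coeff_sub, coeff_monomial, coeff_monomial, if_pos rfl, if_neg hne,
        sub_zero]
      exact mul_ne_zero hα hδ
    · intro e he hne'
      rw [mem_support_iff, coeff_sub, coeff_monomial, coeff_monomial, if_neg hne'.symm] at he
      obtain rfl : quad v₁ v₂ + Finsupp.single w 1 = e := by
        by_contra h; simp [h] at he
      rwa [map_add, weightHom_quad, weightHom_single, mul_one]

/-- Two distinct elements of `F` that share a variable: their six variables are distinct, and
the syzygy between them gives a third element. -/
lemma binom_mem_of_common {z u w y v t : Fin n} {α β γ δ : k} (hα : α ≠ 0) (hβ : β ≠ 0)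
    (hγ : γ ≠ 0) (hδ : δ ≠ 0) (hf : binom z u y v α β ∈ F) (hg : binom z w y t γ δ ∈ F)
    (huw : u ≠ w) : [z, u, y, v, w, t].Nodup ∧
      ∃ κ : k, κ ≠ 0 ∧ binom t u v w (κ * (α * δ)) (-(κ * (β * γ))) ∈ F := by
  classical
  have hP := isBinomialPattern hN hF
  have hf' : HasBinom F z u y v := ⟨α, β, hα, hβ, hf⟩
  have hg' : HasBinom F z w y t := ⟨γ, δ, hγ, hδ, hg⟩
  have hzu : z ≠ u := by
    rintro rfl
    exact huw (hP.eq_of_square hf' hg')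
  have hzw : z ≠ w := by
    rintro rfl
    exact huw (hP.eq_of_square hg' hf').symm
  have hh := hP.of_common hf' hg' huw hzu hzw
  obtain ⟨f1, f2, f3, f4⟩ := hP.disjoint hf'
  obtain ⟨g1, g2, g3, g4⟩ := hP.disjoint hg'
  obtain ⟨h1, h2, h3, h4⟩ := hP.disjoint hh
  have htu : t ≠ u := by
    rintro rfl
    exact hzu (hP.eq_of_square hh (hP.comm hf')).symm
  have hvw : v ≠ w := by
    rintro rfl
    exact hzw (hP.eq_of_square (hP.swap hh) (hP.comm hg')).symm
  have hyv : y ≠ v := by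
    rintro rfl
    exact h1 (hP.eq_of_square (hP.swap hf') (hP.swap hg')).symm
  have hyt : y ≠ t := by
    rintro rfl
    exact h1 (hP.eq_of_square (hP.swap hg') (hP.swap hf'))
  refine ⟨by simp; grind, ?_⟩
  have hh' := hh
  obtain ⟨α', β', hα', hβ', hm⟩ := hh
  refine ⟨α' / (α * δ), div_ne_zero hα' (mul_ne_zero hα hδ), ?_⟩
  -- If the third element were not proportional to the syzygy divided by y, cancelling t u y would
  -- leave the monomial y v w in the ideal. The weight below gives y v, y w and v w only heavier
  -- partners, so none of them leads an element.
  have hs : α' * (β * γ) + β' * (α * δ) = 0 := by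
    by_contra hne
    have e1 : Finsupp.single y 1 + quad t u = quad y t + Finsupp.single u 1 := by
      simp only [quad]; abel
    have e2 : Finsupp.single y 1 + quad v w = quad y v + Finsupp.single w 1 := by
      simp only [quad]; abel
    have hmem : monomial (quad y v + Finsupp.single w 1) (α' * (β * γ) + β' * (α * δ)) ∈
        Ideal.span F := by
      have : monomial (quad y v + Finsupp.single w 1) (α' * (β * γ) + β' * (α * δ)) =
          monomial (Finsupp.single y 1) (α * δ) * binom t u v w α' β' -
          C α' * (monomial (quad y t + Finsupp.single u 1) (α * δ) -
            monomial (quad y v + Finsupp.single w 1) (β * γ)) := by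
        simp only [binom, mul_add, mul_sub, monomial_mul, C_mul_monomial, e1, e2,
          mul_comm α' (α * δ), mul_comm β' (α * δ), map_add]
        ring
      rw [this]
      exact sub_mem (Ideal.mul_mem_left _ _ (Ideal.subset_span hm))
        (Ideal.mul_mem_left _ _ (syzygy_mem hf hg))
    rcases exists_hasBinom hN hF
      (fun s => if s = z then 1000 else if s = v then 5 else if s = w then 0 else 4) hmem
      (a := y) (b := v) (c := w) (by rw [mem_support_iff, coeff_monomial, if_pos rfl]; exact hne)
      (fun e he hne' => absurd (by simpa using support_monomial_subset he) hne') with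
      ⟨p, q, hpq, hle⟩ | ⟨p, q, hpq, hle⟩ | ⟨p, q, hpq, hle⟩
    · have := hP.unique hpq (hP.swap hf')
      grind
    · have := hP.disjoint hpq
      grind
    · have := hP.unique hpq (hP.swap hh')
      grind
  have k1 : α' / (α * δ) * (α * δ) = α' := div_mul_cancel₀ _ (mul_ne_zero hα hδ)
  have k2 : -(α' / (α * δ) * (β * γ)) = β' := by
    field_simp
    linear_combination -hs
  rwa [k1, k2]

end Robust

/-! ### Matrices of variables whose minors lie in F, and adding a column. -/

lemma binom_eq (a b p q : Fin n) (α β : k) :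
    binom a b p q α β = C α * (X a * X b) + C β * (X p * X q) := by
  simp [binom, quad, X, monomial_mul, C_mul_monomial]

lemma C_mul_rescale_minor {m : ℕ} (x y : Fin m → Fin n) (t : Fin n → kˣ) (c : k) (i j : Fin m) :
    C c * rescale t (minor (variableMatrix k x y) i j) =
      binom (x i) (y j) (x j) (y i) (c * (t (x i) * t (y j))) (-(c * (t (x j) * t (y i)))) := by
  simp [minor, variableMatrix, Matrix.det_fin_two, rescale, binom_eq]
  ring

/-- The rescaled minors of the matrix with rows `x` and `y`. -/
def rescaledMinors {m : ℕ} (x y : Fin m → Fin n) (t : Fin n → kˣ) (c : Fin m → Fin m → kˣ) :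
    Set (MvPolynomial (Fin n) k) :=
  {f | ∃ i j : Fin m, i < j ∧ f = C (c i j : k) * rescale t (minor (variableMatrix k x y) i j)}

lemma rescaledMinors_swap {m : ℕ} (x y : Fin m → Fin n) (t : Fin n → kˣ)
    (c : Fin m → Fin m → kˣ) :
    rescaledMinors y x t (fun i j => -c i j) = rescaledMinors x y t c := by
  ext f
  simp only [rescaledMinors, Set.mem_ofPred_eq, C_mul_rescale_minor]
  refine exists₂_congr fun i j => and_congr_right fun _ => ?_
  rw [binom_swap (x i), binom_comm_left (x j), binom_comm_right _ _ (x i)]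
  simp only [Units.val_neg, neg_mul, neg_neg, mul_comm (t (y i) : k), mul_comm (t (y j) : k)]

/-- `F` contains the minors of the matrix with rows `x` and `y`, up to rescaling. -/
structure ContainsMinors (F : Set (MvPolynomial (Fin n) k)) {m : ℕ} (x y : Fin m → Fin n)
    (t : Fin n → kˣ) (c : Fin m → Fin m → kˣ) : Prop where
  inj : Function.Injective (Sum.elim x y)
  subset : rescaledMinors x y t c ⊆ F

namespace ContainsMinors

variable {F : Set (MvPolynomial (Fin n) k)} {m : ℕ} {x y : Fin m → Fin n} {t : Fin n → kˣ}
  {c : Fin m → Fin m → kˣ} (h : ContainsMinors F x y t c)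
include h

lemma x_inj {i j : Fin m} (hij : i ≠ j) : x i ≠ x j := fun e =>
  hij (Sum.inl_injective (h.inj (a₁ := Sum.inl i) (a₂ := Sum.inl j) e))

lemma y_inj {i j : Fin m} (hij : i ≠ j) : y i ≠ y j := fun e =>
  hij (Sum.inr_injective (h.inj (a₁ := Sum.inr i) (a₂ := Sum.inr j) e))

lemma x_ne_y (i j : Fin m) : x i ≠ y j := fun e =>
  Sum.inl_ne_inr (h.inj (a₁ := Sum.inl i) (a₂ := Sum.inr j) e)

omit h in
lemma exists_binom_mem {i j : Fin m} (hij : i ≠ j) :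
    ∃ a : kˣ, binom (x i) (y j) (x j) (y i) ((a : k) * (t (x i) * t (y j)))
      (-((a : k) * (t (x j) * t (y i)))) ∈ rescaledMinors x y t c := by
  rcases lt_or_gt_of_ne hij with hlt | hlt
  · exact ⟨c i j, i, j, hlt, by rw [← C_mul_rescale_minor]⟩
  · refine ⟨-c j i, j, i, hlt, ?_⟩
    rw [C_mul_rescale_minor, binom_swap]
    simp

lemma swap_rows : ContainsMinors F y x t (fun i j => -c i j) where
  inj := by
    have : Sum.elim y x = Sum.elim x y ∘ Sum.swap := by ext s; cases s <;> rfl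
    rw [this]
    exact h.inj.comp Sum.swap_leftInverse.injective
  subset := by rw [rescaledMinors_swap]; exact h.subset

/-- An element of `F` with a monomial divisible by `x i` and the other one divisible by `y i`
extends the matrix by one column. -/
lemma extend (hN : ∀ f ∈ F, IsNormal f) (hF : IsRobust F) {i : Fin m} {w q : Fin n} {γ δ : k}
    (hγ : γ ≠ 0) (hδ : δ ≠ 0) (hg : binom (x i) w (y i) q γ δ ∈ F)
    (hd : [x i, y i, w, q].Nodup) (hw : ∀ j, w ≠ y j) :
    ∃ (t' : Fin n → kˣ) (c' : Fin (m + 1) → Fin (m + 1) → kˣ),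
      ContainsMinors F (Fin.cons q x : Fin (m + 1) → Fin n) (Fin.cons w y) t' c' := by
  classical
  -- The new column is (q, w). Its minor with column j is the third element produced by the minor on
  -- columns i, j and the given element, which share x i and y i.
  have key : ∀ j, j ≠ i → [x i, y j, y i, x j, w, q].Nodup ∧ ∃ κ : kˣ,
      binom q (y j) (x j) w ((κ : k) * (t (x i) * t (y j) * δ))
        (κ * (t (x j) * t (y i) * γ)) ∈ F := by
    intro j hj
    obtain ⟨a, ha⟩ := exists_binom_mem (x := x) (y := y) (t := t) (c := c) hj.symm
    replace ha := h.subset ha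
    rw [binom_comm_right] at ha
    obtain ⟨hnd, κ, hκ, hm⟩ := binom_mem_of_common hN hF (by simp) (by simp) hγ hδ ha hg
      (hw j).symm
    refine ⟨hnd, Units.mk0 κ hκ * a, ?_⟩
    convert hm using 1
    simp only [Units.val_mul, Units.val_mk0]
    congr 1 <;> ring
  have hx : ∀ j, w ≠ x j ∧ q ≠ x j ∧ q ≠ y j := by
    intro j
    by_cases hj : j = i
    · subst hj
      simp only [List.nodup_cons, List.mem_cons] at hd
      grind
    · have := (key j hj).1
      simp only [List.nodup_cons, List.mem_cons] at this
      grind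
  have hwq : w ≠ q := by
    simp only [List.nodup_cons, List.mem_cons] at hd
    grind
  have hq : ∀ j, q ≠ x j ∧ q ≠ y j := fun j => (hx j).2
  -- With q scaled by 1, this scale of w makes the given element a multiple of the minor with column
  -- i; the syzygy coefficients then fit all other columns.
  set s : kˣ := -(Units.mk0 γ hγ * (Units.mk0 δ hδ)⁻¹ * t (y i) * (t (x i))⁻¹) with hs
  set t' : Fin n → kˣ := Function.update (Function.update t q 1) w s with ht'
  have ht'x : ∀ j, t' (x j) = t (x j) := fun j => by
    rw [ht', Function.update_of_ne (hx j).1.symm, Function.update_of_ne (hx j).2.1.symm]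
  have ht'y : ∀ j, t' (y j) = t (y j) := fun j => by
    rw [ht', Function.update_of_ne (hw j).symm, Function.update_of_ne (hx j).2.2.symm]
  have ht'q : t' q = 1 := by
    rw [ht', Function.update_of_ne hwq.symm, Function.update_self]
  have ht'w : t' w = s := by rw [ht', Function.update_self]
  have hsv : (s : k) = -(γ * δ⁻¹ * t (y i) * (t (x i) : k)⁻¹) := by simp [hs]
  have hcol : ∀ j, ∃ a : kˣ, binom q (y j) (x j) w ((a : k) * (t' q * t' (y j)))
      (-(a * (t' (x j) * t' w))) ∈ F := by
    intro j
    rw [ht'x, ht'y, ht'q, ht'w, hsv]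
    by_cases hj : j = i
    · subst hj
      refine ⟨Units.mk0 δ hδ * (t (y j))⁻¹, ?_⟩
      rw [binom_swap, binom_comm_left] at hg
      convert hg using 1
      simp only [Units.val_mul, Units.val_mk0, Units.val_inv_eq_inv_val, Units.val_one]
      congr 1 <;> field_simp
    · obtain ⟨-, κ, hm⟩ := key j hj
      refine ⟨κ * t (x i) * Units.mk0 δ hδ, ?_⟩
      convert hm using 1
      simp only [Units.val_mul, Units.val_mk0, Units.val_one]
      congr 1 <;> field_simp
  choose a ha using hcol
  -- The entries 1 are placeholders: only constants with first index below the second are used.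
  refine ⟨t', Fin.cons (Fin.cons 1 a) fun i => Fin.cons 1 (c i),
    ?_, ?_⟩
  · refine Function.Injective.sumElim ?_ ?_ ?_
    · rw [Fin.cons_injective_iff]
      exact ⟨fun ⟨j, hj⟩ => (hx j).2.1 hj.symm, h.inj.comp Sum.inl_injective⟩
    · rw [Fin.cons_injective_iff]
      exact ⟨fun ⟨j, hj⟩ => hw j hj.symm, h.inj.comp Sum.inr_injective⟩
    · intro i j
      cases i using Fin.cases <;> cases j using Fin.cases <;> simp only [Fin.cons_zero, Fin.cons_succ]
      · exact hwq.symm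
      · exact (hx _).2.2
      · exact (hx _).1.symm
      · exact h.x_ne_y _ _
  · rintro _ ⟨i, j, hij, rfl⟩
    rw [C_mul_rescale_minor]
    cases j using Fin.cases with
    | zero => exact absurd hij (Fin.not_lt_zero _)
    | succ j =>
      cases i using Fin.cases with
      | zero => exact ha j
      | succ i =>
        simp only [Fin.cons_succ, ht'x, ht'y]
        rw [← C_mul_rescale_minor]
        exact h.subset ⟨i, j, Fin.succ_lt_succ_iff.1 hij, rfl⟩

/-- If a further element of `F` shares a variable with one of at least three columns, then the
matrix can be extended. -/
lemma extend_of_binom_mem (hN : ∀ f ∈ F, IsNormal f) (hF : IsRobust F) (hm : 3 ≤ m) {i : Fin m}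
    {w p q : Fin n} {γ δ : k} (hγ : γ ≠ 0) (hδ : δ ≠ 0) (hg : binom (x i) w p q γ δ ∈ F)
    (hnew : binom (x i) w p q γ δ ∉ rescaledMinors x y t c) :
    ∃ (x' y' : Fin (m + 1) → Fin n) (t' : Fin n → kˣ) (c' : Fin (m + 1) → Fin (m + 1) → kˣ),
      ContainsMinors F x' y' t' c' := by
  have hP := isBinomialPattern hN hF
  have hg' : HasBinom F (x i) w p q := ⟨γ, δ, hγ, hδ, hg⟩
  have hB : ∀ {i j : Fin m}, i ≠ j → HasBinom F (x i) (y j) (x j) (y i) := by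
    intro i j hij
    obtain ⟨a, ha⟩ := exists_binom_mem (x := x) (y := y) (t := t) (c := c) hij
    exact ⟨_, _, by simp, by simp, h.subset ha⟩
  have hw : ∀ j, j ≠ i → y j ≠ w := by
    rintro j hj rfl
    obtain ⟨a, ha⟩ := exists_binom_mem (x := x) (y := y) (t := t) (c := c) hj.symm
    refine hnew ?_
    rwa [eq_of_common_monomial hN hF hγ hδ (by simp) (by simp) hg (h.subset ha)]
  obtain ⟨j, l, hj, hl, hjl⟩ : ∃ j l : Fin m, j ≠ i ∧ l ≠ i ∧ j ≠ l := by
    by_cases h0 : (i : ℕ) = 0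
    · exact ⟨⟨1, by omega⟩, ⟨2, by omega⟩, by simp [Fin.ext_iff]; omega,
        by simp [Fin.ext_iff]; omega, by simp⟩
    by_cases h1 : (i : ℕ) = 1
    · exact ⟨⟨0, by omega⟩, ⟨2, by omega⟩, by simp [Fin.ext_iff]; omega,
        by simp [Fin.ext_iff]; omega, by simp⟩
    · exact ⟨⟨0, by omega⟩, ⟨1, by omega⟩, by simp [Fin.ext_iff]; omega,
        by simp [Fin.ext_iff]; omega, by simp⟩
  have hext : ∀ {q : Fin n} {δ : k}, δ ≠ 0 → binom (x i) w (y i) q γ δ ∈ F →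
      ∃ (x' y' : Fin (m + 1) → Fin n) (t' : Fin n → kˣ) (c' : Fin (m + 1) → Fin (m + 1) → kˣ),
        ContainsMinors F x' y' t' c' := by
    intro q δ hδ hg
    obtain ⟨a, ha⟩ := exists_binom_mem (x := x) (y := y) (t := t) (c := c) hj.symm
    replace ha := h.subset ha
    rw [binom_comm_right] at ha
    obtain ⟨hnd, -⟩ := binom_mem_of_common hN hF (by simp) (by simp) hγ hδ ha hg (hw j hj)
    simp only [List.nodup_cons, List.mem_cons] at hnd
    refine ⟨_, _, h.extend hN hF hγ hδ hg ?_ ?_⟩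
    · simp only [List.nodup_cons, List.mem_cons]
      grind
    · intro j' e
      by_cases hj' : j' = i
      · subst hj'; grind
      · exact hw j' hj' e.symm
  by_cases hp : p = y i
  · subst hp
    exact hext hδ hg
  by_cases hq : q = y i
  · subst hq
    rw [binom_comm_right] at hg
    exact hext hδ hg
  exfalso
  have hxw : x i ≠ w := by
    intro e
    rw [← e] at hg'
    exact h.x_ne_y i j (hP.eq_of_square hg' (hB hj.symm))
  -- If y i is not in {p, q}, the shared variable with the minor on columns i, j must be x j. Two
  -- such columns j, l, hence three in all, give p q = x j x l; then x l y j would have both y i w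
  -- and x j y l as partner.
  have key : ∀ j, j ≠ i → ∃ s, ((p = x j ∧ q = s) ∨ (p = s ∧ q = x j)) ∧
      HasBinom F s (y j) (y i) w := by
    intro j hj
    obtain ⟨y', v, s, h1, h2, h3⟩ := hP.exists_common (hB hj.symm) hg' (hw j hj) (h.x_ne_y _ _) hxw
    refine ⟨s, by grind, ?_⟩
    have : v = y i := by grind
    rwa [this] at h3
  obtain ⟨s, h1, h2⟩ := key j hj
  obtain ⟨s', h3, -⟩ := key l hl
  have hs : s = x l := by have := h.x_inj hjl; grind
  subst hs
  have := hP.unique h2 (hB hjl.symm)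
  have := h.x_ne_y j i
  have := h.y_inj hl
  grind

end ContainsMinors

lemma IsNormal.exists_of_mem_vars {f : MvPolynomial (Fin n) k} (hf : IsNormal f) {s : Fin n}
    (hs : s ∈ f.vars) : ∃ (b p q : Fin n) (α β : k), α ≠ 0 ∧ β ≠ 0 ∧ f = binom s b p q α β := by
  obtain ⟨a, b, p, q, α, β, hα, hβ, rfl, -⟩ := hf
  obtain ⟨d, hd, hsd⟩ := mem_vars_iff_mem_support _ |>.1 hs
  rw [Finsupp.mem_support_iff] at hsd
  rcases mem_support_binom hd with rfl | rfl
  · rw [quad_apply] at hsd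
    rcases (by grind : a = s ∨ b = s) with rfl | rfl
    · exact ⟨b, p, q, α, β, hα, hβ, rfl⟩
    · exact ⟨a, p, q, α, β, hα, hβ, binom_comm_left _ _ _ _ _ _⟩
  · rw [quad_apply] at hsd
    rcases (by grind : p = s ∨ q = s) with rfl | rfl
    · exact ⟨q, a, b, β, α, hβ, hα, binom_swap _ _ _ _ _ _⟩
    · refine ⟨p, a, b, β, α, hβ, hα, ?_⟩
      rw [binom_swap, binom_comm_left]

/-! ### Growing the matrix until it exhausts F. -/

lemma IsIndecomposable.exists_common_var {F G : Set (MvPolynomial (Fin n) k)}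
    (hF : IsIndecomposable F) (hG : G.Nonempty) (hGF : G ⊆ F) (hne : (F \ G).Nonempty) :
    ∃ g ∈ G, ∃ f ∈ F, f ∉ G ∧ ∃ s, s ∈ g.vars ∧ s ∈ f.vars := by
  by_contra! h
  refine hF ⟨G, F \ G, hG, hne, (Set.union_sdiff_cancel hGF).symm, fun g hg f hf => ?_⟩
  exact Finset.disjoint_left.2 fun s hs hs' => h g hg f hf.1 hf.2 s hs hs'

section

variable {F : Set (MvPolynomial (Fin n) k)} (hN : ∀ f ∈ F, IsNormal f) (hF : IsRobust F)
  (hI : IsIndecomposable F)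
include hN hF hI

lemma exists_containsMinors_succ (hM : ¬ IsRescaledGenericMinors F) {m : ℕ} (hm : 3 ≤ m)
    (h : ∃ (x y : Fin m → Fin n) (t : Fin n → kˣ) (c : Fin m → Fin m → kˣ),
      ContainsMinors F x y t c) :
    ∃ (x y : Fin (m + 1) → Fin n) (t : Fin n → kˣ) (c : Fin (m + 1) → Fin (m + 1) → kˣ),
      ContainsMinors F x y t c := by
  obtain ⟨x, y, t, c, h⟩ := h
  have hne : (F \ rescaledMinors x y t c).Nonempty := by
    rw [Set.nonempty_iff_ne_empty, Ne, Set.sdiff_eq_empty]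
    intro hsub
    exact hM ⟨m, x, y, t, c, h.inj, hsub.antisymm h.subset⟩
  obtain ⟨_, ⟨i, j, hij, rfl⟩, g, hg, hgn, s, hs, hsg⟩ := hI.exists_common_var
    (G := rescaledMinors x y t c)
    ⟨_, ⟨0, by omega⟩, ⟨1, by omega⟩, by simp [Fin.lt_def], rfl⟩ h.subset hne
  obtain ⟨w, p, q, γ, δ, hγ, hδ, rfl⟩ := (hN g hg).exists_of_mem_vars hsg
  have hx : ∀ i, s ≠ x i ∨ ∃ (x y : Fin (m + 1) → Fin n) (t : Fin n → kˣ)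
      (c : Fin (m + 1) → Fin (m + 1) → kˣ), ContainsMinors F x y t c := by
    intro i
    by_contra! hi
    obtain ⟨rfl, hi⟩ := hi
    obtain ⟨x', y', t', c', h'⟩ := h.extend_of_binom_mem hN hF hm hγ hδ hg hgn
    exact hi x' y' t' c' h'
  have hy : ∀ i, s ≠ y i ∨ ∃ (x y : Fin (m + 1) → Fin n) (t : Fin n → kˣ)
      (c : Fin (m + 1) → Fin (m + 1) → kˣ), ContainsMinors F x y t c := by
    intro i
    by_contra! hi
    obtain ⟨rfl, hi⟩ := hi
    -- Exchanging the rows only changes the signs of the minors.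
    obtain ⟨x', y', t', c', h'⟩ := h.swap_rows.extend_of_binom_mem hN hF hm hγ hδ hg
      (by rwa [rescaledMinors_swap])
    exact hi x' y' t' c' h'
  rw [C_mul_rescale_minor] at hs
  obtain ⟨d, hd, hsd⟩ := mem_vars_iff_mem_support _ |>.1 hs
  rw [Finsupp.mem_support_iff] at hsd
  have hx1 := hx i
  have hx2 := hx j
  have hy1 := hy i
  have hy2 := hy j
  rcases mem_support_binom hd with rfl | rfl <;> rw [quad_apply] at hsd <;> grind

lemma exists_containsMinors_three {f g : MvPolynomial (Fin n) k} (hf : f ∈ F) (hg : g ∈ F)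
    (hne : f ≠ g) : ∃ (x y : Fin 3 → Fin n) (t : Fin n → kˣ) (c : Fin 3 → Fin 3 → kˣ),
      ContainsMinors F x y t c := by
  have hP := isBinomialPattern hN hF
  obtain ⟨_, rfl, g, hg, hgf, z, hzf, hzg⟩ := hI.exists_common_var (G := {f}) ⟨f, rfl⟩
    (by simpa using hf) ⟨g, hg, hne.symm⟩
  obtain ⟨u, v₁, v₂, α, β, hα, hβ, rfl⟩ := (hN _ hf).exists_of_mem_vars hzf
  obtain ⟨w, t₁, t₂, γ, δ, hγ, hδ, rfl⟩ := (hN _ hg).exists_of_mem_vars hzg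
  have hf' : HasBinom F z u v₁ v₂ := ⟨α, β, hα, hβ, hf⟩
  have hg' : HasBinom F z w t₁ t₂ := ⟨γ, δ, hγ, hδ, hg⟩
  have huw : u ≠ w := by
    rintro rfl
    exact hgf (eq_of_common_monomial hN hF hγ hδ hα hβ hg hf)
  have hzu : z ≠ u := by
    rintro rfl
    exact huw (hP.eq_of_square hf' hg')
  have hzw : z ≠ w := by
    rintro rfl
    exact huw (hP.eq_of_square hg' hf').symm
  obtain ⟨y, v, t, hv, ht, -⟩ := hP.exists_common hf' hg' huw hzu hzw
  have hf1 : binom z u y v α β ∈ F := by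
    rcases hv with ⟨rfl, rfl⟩ | ⟨rfl, rfl⟩
    · exact hf
    · rwa [binom_comm_right] at hf
  have hg1 : binom z w y t γ δ ∈ F := by
    rcases ht with ⟨rfl, rfl⟩ | ⟨rfl, rfl⟩
    · exact hg
    · rwa [binom_comm_right] at hg
  obtain ⟨hnd, -⟩ := binom_mem_of_common hN hF hα hβ hγ hδ hf1 hg1 huw
  simp only [List.nodup_cons, List.mem_cons] at hnd
  -- The single column (z, y) has no minors; the two elements then add the columns (v, u) and (t,
  -- w). New columns go in front, so (z, y) has index 1 at the second extension.
  have h1 : ContainsMinors F (fun _ : Fin 1 => z) (fun _ => y) (fun _ => 1) (fun _ _ => 1) := by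
    constructor
    · refine Function.Injective.sumElim (Function.injective_of_subsingleton _)
        (Function.injective_of_subsingleton _) (by grind)
    · rintro _ ⟨i, j, hij, -⟩
      exact absurd hij (by simp [Subsingleton.elim i j])
  obtain ⟨t₂, c₂, h2⟩ := h1.extend hN hF (i := 0) hα hβ hf1
    (by simp only [List.nodup_cons, List.mem_cons]; grind) (by grind)
  obtain ⟨t₃, c₃, h3⟩ := h2.extend hN hF (i := 1) hγ hδ hg1
    (by
      change [z, y, w, t].Nodup
      simp only [List.nodup_cons, List.mem_cons]; grind)
    (by
      intro j
      cases j using Fin.cases with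
      | zero => exact huw.symm
      | succ j => simp only [Fin.cons_succ]; grind)
  exact ⟨_, _, _, _, h3⟩

theorem isRescaledGenericMinors_of_isRobust {f g : MvPolynomial (Fin n) k} (hf : f ∈ F)
    (hg : g ∈ F) (hne : f ≠ g) : IsRescaledGenericMinors F := by
  by_contra hM
  have h : ∀ m, 3 ≤ m → ∃ (x y : Fin m → Fin n) (t : Fin n → kˣ) (c : Fin m → Fin m → kˣ),
      ContainsMinors F x y t c := by
    intro m hm
    induction m, hm using Nat.le_induction with
    | base => exact exists_containsMinors_three hN hF hI hf hg hne
    | succ m hm ih => exact exists_containsMinors_succ hN hF hI hM hm ih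
  obtain ⟨x, y, t, c, h⟩ := h (n + 3) (by omega)
  have := Fintype.card_le_of_injective _ (h.inj.comp Sum.inl_injective)
  simp at this

end

/-! ### The converse: principal ideals and generic minors are robust. -/

lemma isRobust_singleton {f : MvPolynomial (Fin n) k} (hf : f ≠ 0) : IsRobust {f} := by
  constructor
  · intro m
    rw [isGroebnerBasis_iff]
    intro p hp hp0
    obtain ⟨q, rfl⟩ := Ideal.mem_span_singleton.1 hp
    refine ⟨f, rfl, hf, ?_⟩
    rw [m.degree_mul hf (right_ne_zero_of_mul hp0)]
    exact le_self_add
  · intro G hG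
    rw [Set.ssubset_singleton_iff] at hG
    subst hG
    intro h
    rw [Ideal.span_empty, eq_comm, Ideal.span_singleton_eq_bot] at h
    exact hf h

/-- If no monomial dividing `u` occurs in `G`, then none occurs in the ideal `(G)`. -/
lemma coeff_eq_zero_of_mem_span {G : Set (MvPolynomial (Fin n) k)} {u : Fin n →₀ ℕ}
    (h : ∀ g ∈ G, ∀ d ≤ u, coeff d g = 0) {p : MvPolynomial (Fin n) k} (hp : p ∈ Ideal.span G) :
    ∀ d ≤ u, coeff d p = 0 := by
  classical
  induction hp using Submodule.span_induction with
  | mem g hg => exact h g hg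
  | zero => simp
  | add p q _ _ hp hq => intro d hd; rw [coeff_add, hp d hd, hq d hd, add_zero]
  | smul r p _ hp =>
    intro d hd
    rw [smul_eq_mul, coeff_mul]
    refine Finset.sum_eq_zero fun e he => ?_
    rw [Finset.HasAntidiagonal.mem_antidiagonal] at he
    rw [hp e.2 ((le_add_self.trans he.le).trans hd), mul_zero]

lemma eq_of_quad_le {a b p q : Fin n} (h : quad a b ≤ quad p q) : quad a b = quad p q := by
  obtain ⟨e, he⟩ := exists_add_of_le h
  have : e.degree = 0 := by
    have := congrArg Finsupp.degree he
    simpa [quad, map_add] using this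
  rw [Finsupp.degree_eq_zero_iff] at this
  rw [he, this, add_zero]

/-! ### The toric parametrization of the minors on exponent vectors. -/

section Toric

variable {m : ℕ} (x y : Fin m → Fin n)

open Classical in
/-- Exponent vectors of the toric parametrization with `x i ↦ y i * none` that fixes all other
variables. -/
noncomputable def toricExponent (s : Fin n) : Option (Fin n) →₀ ℕ :=
  if h : ∃ i, x i = s then Finsupp.single (some (y h.choose)) 1 + Finsupp.single none 1
  else Finsupp.single (some s) 1

variable {x y} (hinj : Function.Injective (Sum.elim x y))
include hinj

lemma toricExponent_x (i : Fin m) :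
    toricExponent x y (x i) = Finsupp.single (some (y i)) 1 + Finsupp.single none 1 := by
  have h : ∃ j, x j = x i := ⟨i, rfl⟩
  have hi : h.choose = i :=
    Sum.inl_injective (hinj (a₁ := Sum.inl h.choose) (a₂ := Sum.inl i) h.choose_spec)
  rw [toricExponent, dif_pos h, hi]

omit hinj in
lemma toricExponent_of_ne {s : Fin n} (hs : ∀ i, x i ≠ s) :
    toricExponent x y s = Finsupp.single (some s) 1 := by
  rw [toricExponent, dif_neg (by simpa using hs)]

lemma toricExponent_y (i : Fin m) :
    toricExponent x y (y i) = Finsupp.single (some (y i)) 1 :=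
  toricExponent_of_ne fun j e => Sum.inl_ne_inr (hinj (a₁ := Sum.inl j) (a₂ := Sum.inr i) e)

/-- The map on exponent vectors induced by the toric parametrization. -/
noncomputable def toricHom (x y : Fin m → Fin n) : (Fin n →₀ ℕ) →ₗ[ℕ] (Option (Fin n) →₀ ℕ) :=
  Finsupp.linearCombination ℕ (toricExponent x y)

omit hinj in
lemma toricHom_apply (d : Fin n →₀ ℕ) (o : Option (Fin n)) :
    toricHom x y d o = ∑ s, d s * toricExponent x y s o := by
  rw [toricHom, Finsupp.linearCombination_apply, Finsupp.sum_fintype _ _ (by simp)]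
  simp [Finsupp.finsetSum_apply]

lemma toricHom_none (d : Fin n →₀ ℕ) : toricHom x y d none = ∑ i, d (x i) := by
  classical
  have hx : Function.Injective x := hinj.comp Sum.inl_injective
  rw [toricHom_apply, ← Finset.sum_image (s := Finset.univ) (g := x) (f := fun s => d s) hx.injOn]
  symm
  rw [← Finset.sum_subset (Finset.subset_univ (Finset.univ.image x))]
  · refine Finset.sum_congr rfl fun s hs => ?_
    obtain ⟨i, -, rfl⟩ := Finset.mem_image.1 hs
    simp [toricExponent_x hinj]
  · intro s _ hs
    rw [toricExponent_of_ne (fun i e => hs (Finset.mem_image.2 ⟨i, Finset.mem_univ _, e⟩))]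
    simp

lemma toricHom_y (d : Fin n →₀ ℕ) (i : Fin m) :
    toricHom x y d (some (y i)) = d (x i) + d (y i) := by
  classical
  have hy : Function.Injective y := hinj.comp Sum.inr_injective
  have hxy : x i ≠ y i := fun e => Sum.inl_ne_inr (hinj (a₁ := Sum.inl i) (a₂ := Sum.inr i) e)
  rw [toricHom_apply, ← Finset.sum_subset (Finset.subset_univ {x i, y i}), Finset.sum_pair hxy]
  · simp [toricExponent_x hinj, toricExponent_y hinj]
  · intro s _ hs
    simp only [Finset.mem_insert, Finset.mem_singleton, not_or] at hs
    by_cases h : ∃ j, x j = s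
    · obtain ⟨j, rfl⟩ := h
      have : y j ≠ y i := fun e => hs.1 (by rw [hy e])
      simp [toricExponent_x hinj, this]
    · rw [toricExponent_of_ne (by simpa using h)]
      simp [hs.2]

lemma toricHom_of_ne (d : Fin n →₀ ℕ) {s : Fin n} (hx : ∀ i, x i ≠ s) (hy : ∀ i, y i ≠ s) :
    toricHom x y d (some s) = d s := by
  rw [toricHom_apply, Finset.sum_eq_single s]
  · simp [toricExponent_of_ne hx]
  · intro s' _ hs'
    by_cases h : ∃ j, x j = s'
    · obtain ⟨j, rfl⟩ := h
      simp [toricExponent_x hinj, hy j]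
    · rw [toricExponent_of_ne (by simpa using h)]
      simp [hs']
  · simp

/-- Distinct monomials with the same image are divisible by the two terms of a minor. -/
lemma exists_quad_le_of_toricHom_eq {d d' : Fin n →₀ ℕ} (h : toricHom x y d = toricHom x y d')
    (hne : d ≠ d') : ∃ i j, i ≠ j ∧ quad (x i) (y j) ≤ d ∧ quad (x j) (y i) ≤ d' := by
  have hsum : ∑ i, d (x i) = ∑ i, d' (x i) := by
    rw [← toricHom_none hinj, h, toricHom_none hinj]
  have hcol : ∀ i, d (x i) + d (y i) = d' (x i) + d' (y i) := fun i => by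
    rw [← toricHom_y hinj, h, toricHom_y hinj]
  have hxne : ¬ ∀ i, d (x i) = d' (x i) := by
    intro hx
    refine hne (Finsupp.ext fun s => ?_)
    by_cases h1 : ∃ i, x i = s
    · obtain ⟨i, rfl⟩ := h1
      exact hx i
    by_cases h2 : ∃ i, y i = s
    · obtain ⟨i, rfl⟩ := h2
      have := hcol i
      have := hx i
      omega
    · push Not at h1 h2
      rw [← toricHom_of_ne hinj d h1 h2, h, toricHom_of_ne hinj d' h1 h2]
  -- The total x-degree and each column degree agree, so an excess of x i in d is balanced by a
  -- deficit of some x j, that is, by an excess of y j.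
  have h1 : ∃ i, d' (x i) < d (x i) := by
    by_contra! hle
    exact hxne fun i => (Finset.sum_eq_sum_iff_of_le fun i _ => hle i).1 hsum i (Finset.mem_univ i)
  have h2 : ∃ j, d (x j) < d' (x j) := by
    by_contra! hle
    exact hxne fun i =>
      ((Finset.sum_eq_sum_iff_of_le fun i _ => hle i).1 hsum.symm i (Finset.mem_univ i)).symm
  obtain ⟨i, hi⟩ := h1
  obtain ⟨j, hj⟩ := h2
  have hij : i ≠ j := by rintro rfl; omega
  have hle : ∀ {i j : Fin m} {d : Fin n →₀ ℕ}, 0 < d (x i) → 0 < d (y j) → quad (x i) (y j) ≤ d := by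
    intro i j d h1 h2 s
    have : x i ≠ y j := fun e => Sum.inl_ne_inr (hinj (a₁ := Sum.inl i) (a₂ := Sum.inr j) e)
    rw [quad_apply]
    grind
  have ci := hcol i
  have cj := hcol j
  exact ⟨i, j, hij, hle (by omega) (by omega), hle (by omega) (by omega)⟩

end Toric

/-- The toric parametrization of the variety of the rescaled minors. -/
noncomputable def toricMap {m : ℕ} (x y : Fin m → Fin n) (t : Fin n → kˣ) :
    MvPolynomial (Fin n) k →ₐ[k] MvPolynomial (Option (Fin n)) k :=
  aeval fun s => monomial (toricExponent x y s) ((t s)⁻¹ : k)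

lemma exists_toricMap_monomial {m : ℕ} (x y : Fin m → Fin n) (t : Fin n → kˣ) (d : Fin n →₀ ℕ) :
    ∃ κ : k, κ ≠ 0 ∧ ∀ a, toricMap x y t (monomial d a) = monomial (toricHom x y d) (a * κ) := by
  induction d using Finsupp.induction_linear with
  | zero => exact ⟨1, one_ne_zero, fun a => by simp [toricMap, monomial_zero']⟩
  | add d e hd he =>
    obtain ⟨κ, hκ, h⟩ := hd
    obtain ⟨κ', hκ', h'⟩ := he
    refine ⟨κ * κ', mul_ne_zero hκ hκ', fun a => ?_⟩
    rw [← mul_one a, ← monomial_mul, map_mul, h, h', monomial_mul, map_add]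
    congr 1; ring
  | single s c =>
    refine ⟨((t s)⁻¹ : k) ^ c, by simp, fun a => ?_⟩
    rw [toricMap, aeval_monomial, Finsupp.prod_single_index (by simp), monomial_pow,
      algebraMap_eq, C_mul_monomial, toricHom, Finsupp.linearCombination_single]

section Minors

variable {m : ℕ} {x y : Fin m → Fin n} (hinj : Function.Injective (Sum.elim x y))
include hinj

lemma toricMap_eq_zero {t : Fin n → kˣ} {c : Fin m → Fin m → kˣ} {p : MvPolynomial (Fin n) k}
    (hp : p ∈ Ideal.span (rescaledMinors x y t c)) : toricMap x y t p = 0 := by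
  suffices h : Ideal.span (rescaledMinors x y t c) ≤ RingHom.ker (toricMap x y t) from h hp
  rw [Ideal.span_le]
  rintro _ ⟨i, j, -, rfl⟩
  rw [SetLike.mem_coe, RingHom.mem_ker, C_mul_rescale_minor, binom_eq]
  simp only [toricMap, map_add, map_mul, aeval_X, algHom_C, algebraMap_eq, monomial_mul,
    C_mul_monomial, toricExponent_x hinj, toricExponent_y hinj]
  rw [add_right_comm, add_right_comm (Finsupp.single (some (y j)) 1),
    add_comm (Finsupp.single (some (y j)) 1), ← C_mul, ← C_mul, C_mul_monomial, ← map_add]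
  refine (congrArg _ ?_).trans (map_zero _)
  field_simp
  ring

/-- The hypothesis makes the images of the monomials of r pairwise distinct, so nothing can cancel
in the vanishing image of r. -/
lemma eq_zero_of_standard {t : Fin n → kˣ} {c : Fin m → Fin m → kˣ} {r : MvPolynomial (Fin n) k}
    (hr : r ∈ Ideal.span (rescaledMinors x y t c))
    (h : ∀ d ∈ r.support, ∀ e ∈ r.support, ∀ i j, i ≠ j →
      ¬ (quad (x i) (y j) ≤ d ∧ quad (x j) (y i) ≤ e)) : r = 0 := by
  by_contra hr0
  obtain ⟨d, hd⟩ := support_nonempty.2 hr0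
  choose κ hκ hφ using exists_toricMap_monomial x y t
  have h0 := toricMap_eq_zero hinj hr
  rw [as_sum r, map_sum] at h0
  have h1 := congrArg (coeff (toricHom x y d)) h0
  rw [coeff_sum, Finset.sum_eq_single d] at h1
  · rw [hφ, coeff_monomial, if_pos rfl, coeff_zero] at h1
    exact mul_ne_zero (mem_support_iff.1 hd) (hκ d) h1
  · intro e he hed
    rw [hφ, coeff_monomial, if_neg]
    intro heq
    obtain ⟨i, j, hij, hle⟩ := exists_quad_le_of_toricHom_eq hinj heq hed
    exact h e he d hd i j hij hle
  · exact fun hd' => absurd hd hd'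

lemma rescaledMinors_cross_ne {i j : Fin m} (hij : i ≠ j) :
    quad (x i) (y j) ≠ quad (x j) (y i) := by
  have h1 : x i ≠ x j := fun e => hij (Sum.inl_injective (hinj (a₁ := Sum.inl i) (a₂ := Sum.inl j) e))
  have h2 : x i ≠ y i := fun e => Sum.inl_ne_inr (hinj (a₁ := Sum.inl i) (a₂ := Sum.inr i) e)
  rw [Ne, quad_inj]
  grind

lemma ne_zero_of_mem_rescaledMinors {t : Fin n → kˣ} {c : Fin m → Fin m → kˣ}
    {f : MvPolynomial (Fin n) k} (hf : f ∈ rescaledMinors x y t c) : f ≠ 0 := by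
  obtain ⟨i, j, hij, rfl⟩ := hf
  rw [C_mul_rescale_minor]
  intro h
  have := congrArg (coeff (quad (x i) (y j))) h
  rw [binom, coeff_add, coeff_monomial, coeff_monomial, if_pos rfl,
    if_neg (rescaledMinors_cross_ne hinj hij.ne).symm] at this
  simp at this

lemma isUniversalGroebnerBasis_rescaledMinors (t : Fin n → kˣ) (c : Fin m → Fin m → kˣ) :
    IsUniversalGroebnerBasis (rescaledMinors x y t c) := by
  intro o
  rw [isGroebnerBasis_iff]
  intro p hp hp0
  obtain ⟨g, r, hgr, hdeg, hr⟩ := o.div_set (B := rescaledMinors x y t c)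
    (fun b hb => MonomialOrder.isUnit_leadingCoeff.2 (ne_zero_of_mem_rescaledMinors hinj hb)) p
  have hlin : Finsupp.linearCombination _
      (fun b : rescaledMinors x y t c => (b : MvPolynomial (Fin n) k)) g ∈
        Ideal.span (rescaledMinors x y t c) := by
    rw [Finsupp.linearCombination_apply]
    exact Submodule.sum_mem _ fun b _ => Submodule.smul_mem _ _ (Ideal.subset_span b.2)
  have hrI : r ∈ Ideal.span (rescaledMinors x y t c) := by
    rw [← add_sub_cancel_left (Finsupp.linearCombination _
      (fun b : rescaledMinors x y t c => (b : MvPolynomial (Fin n) k)) g) r, ← hgr]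
    exact sub_mem hp hlin
  have hr0 : r = 0 := by
    have key : ∀ d ∈ r.support, ∀ e ∈ r.support, ∀ i j, i < j →
        ¬ (quad (x i) (y j) ≤ d ∧ quad (x j) (y i) ≤ e) := by
      rintro d hd e he i j hij ⟨h1, h2⟩
      have hf : C (c i j : k) * rescale t (minor (variableMatrix k x y) i j) ∈
        rescaledMinors x y t c := ⟨i, j, hij, rfl⟩
      have hsupp := o.degree_mem_support (ne_zero_of_mem_rescaledMinors hinj hf)
      rw [C_mul_rescale_minor] at hsupp hf
      rcases mem_support_binom hsupp with h | h
      · exact hr d hd _ hf (h ▸ h1)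
      · exact hr e he _ hf (h ▸ h2)
    refine eq_zero_of_standard hinj hrI fun d hd e he i j hij hle => ?_
    rcases lt_or_gt_of_ne hij with hlt | hlt
    · exact key d hd e he i j hlt hle
    · exact key e he d hd j i hlt hle.symm
  rw [hr0, add_zero] at hgr
  -- With zero remainder, the leading monomial of p appears in some product of the division; the
  -- degree bound makes it the leading monomial of that product.
  by_contra! hnot
  refine (o.coeff_degree_ne_zero_iff).2 hp0 ?_
  nth_rewrite 2 [hgr]
  rw [Finsupp.linearCombination_apply, Finsupp.sum, coeff_sum]
  refine Finset.sum_eq_zero fun b _ => ?_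
  by_contra hne
  rw [smul_eq_mul, mul_comm] at hne
  have hb0 := ne_zero_of_mem_rescaledMinors hinj b.2
  have hg0 : g b ≠ 0 := by rintro h; simp [h] at hne
  have heq : o.degree ((b : MvPolynomial (Fin n) k) * g b) = o.degree p :=
    o.toSyn.injective (le_antisymm (hdeg b) (MonomialOrder.le_degree (mem_support_iff.2 hne)))
  refine hnot b b.2 hb0 ?_
  rw [← heq, o.degree_mul hb0 hg0]
  exact le_self_add

/-- The monomial x_i y_j with i < j occurs in only one minor, and all generators have degree 2, so
the others cannot produce it. -/
lemma minimallyGenerates_rescaledMinors (t : Fin n → kˣ) (c : Fin m → Fin m → kˣ) :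
    MinimallyGenerates (rescaledMinors x y t c) := by
  intro G hG hspan
  obtain ⟨f, hf, hfG⟩ := Set.exists_of_ssubset hG
  have hmem : f ∈ Ideal.span G := hspan ▸ Ideal.subset_span hf
  obtain ⟨i, j, hij, rfl⟩ := hf
  refine absurd (coeff_eq_zero_of_mem_span (u := quad (x i) (y j)) ?_ hmem _ le_rfl) ?_
  · intro g hg d hd
    obtain ⟨i', j', hij', rfl⟩ := hG.1 hg
    by_contra hne
    refine hfG ?_
    have hx : ∀ {i j}, x i = x j → i = j := fun e => (hinj.comp Sum.inl_injective) e
    have hy : ∀ {i j}, y i = y j → i = j := fun e => (hinj.comp Sum.inr_injective) e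
    have hxy : ∀ {i j}, x i ≠ y j := fun {i j} e =>
      Sum.inl_ne_inr (hinj (a₁ := Sum.inl i) (a₂ := Sum.inr j) e)
    have key : i' = i ∧ j' = j := by
      rw [C_mul_rescale_minor] at hne
      rcases mem_support_binom (mem_support_iff.2 hne) with rfl | rfl
      · have := quad_inj.1 (eq_of_quad_le hd)
        grind
      · have := quad_inj.1 (eq_of_quad_le hd)
        grind
    rwa [← key.1, ← key.2]
  · rw [C_mul_rescale_minor, binom, coeff_add, coeff_monomial, coeff_monomial, if_pos rfl,
      if_neg (rescaledMinors_cross_ne hinj hij.ne).symm]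
    simp

end Minors

theorem isRobust_iff (F : Set (MvPolynomial (Fin n) k)) (hind : IsIndecomposable F)
    (hbin : ∀ f ∈ F, IsQuadraticBinomial f) (hirr : ∀ f ∈ F, Irreducible f)
    (hsq : ∀ f ∈ F, ¬ IsCombinationOfTwoSquares f) :
    IsRobust F ↔ F.ncard = 1 ∨ IsRescaledGenericMinors F := by
  have hN : ∀ f ∈ F, IsNormal f := fun f hf => isNormal_of (hbin f hf) (hirr f hf) (hsq f hf)
  constructor
  · intro hF
    by_cases hsub : F.Subsingleton
    · rcases hsub.eq_empty_or_singleton with rfl | ⟨f, rfl⟩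
      · refine Or.inr ⟨0, Fin.elim0, Fin.elim0, 1, 1, Function.injective_of_subsingleton _, ?_⟩
        ext f
        simp
      · exact Or.inl (Set.ncard_singleton f)
    · obtain ⟨f, hf, g, hg, hne⟩ := Set.not_subsingleton_iff.1 hsub
      exact Or.inr (isRescaledGenericMinors_of_isRobust hN hF hind hf hg hne)
  · rintro (h | ⟨m, x, y, t, c, hinj, rfl⟩)
    · obtain ⟨f, rfl⟩ := Set.ncard_eq_one.1 h
      exact isRobust_singleton (hirr f rfl).ne_zero
    · exact ⟨isUniversalGroebnerBasis_rescaledMinors hinj t c,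
        minimallyGenerates_rescaledMinors hinj t c⟩

end RobustQuadrics

theorem theorem2p2 {k : Type*} [Field k] {n : ℕ} (F : Set (MvPolynomial (Fin n) k))
    (hind : RobustQuadrics.IsIndecomposable F)
    (hbin : ∀ f ∈ F, RobustQuadrics.IsQuadraticBinomial f)
    (hirr : ∀ f ∈ F, Irreducible f)
    (hsq : ∀ f ∈ F, ¬ RobustQuadrics.IsCombinationOfTwoSquares f) :
    RobustQuadrics.IsRobust F ↔
      F.ncard = 1 ∨ RobustQuadrics.IsRescaledGenericMinors F :=
  RobustQuadrics.isRobust_iff F hind hbin hirr hsq
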